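/- \textbf{Setting.} Let $\Theta\subset\mathbb R^L$ be a Borel set. For $t\in\mathbb Z$ let $F_t(y\mid x,\theta)$ and $H_t(y\mid x)$, where $y\in\mathbb R$, $x\in\mathbb R^{\mathbb N}$, $\theta\in\Theta$, be conditional distribution functions that are continuous and strictly increasing in $y$ and are measurable in $(x,\theta)$ and in $x$, respectively. Let $\theta_n\in\Theta$ and $0\le\delta_n\le\sqrt n$ be nonrandom for $n\ge 1$, and put $$G_{nt}(y\mid x,\theta)=\Bigl(1-\frac{\delta_n}{\sqrt n}\Bigr)F_t(y\mid x,\theta)+\frac{\delta_n}{\sqrt n}H_t(y\mid x).$$ (A constant $\delta_n=\delta$ gives root-$n$ local alternatives, $\delta_n=0$ the null, $\delta_n=\sqrt n$ a fixed alternative; all conditions on the data are needed for large $n$ only.) For every $n$ let $(Y_{n,t})_{t\in\mathbb Z}$ be a real time series on some probability space, let $\Omega_{nt}=\sigma(Y_{n,t-1},Y_{n,t-2},\dots)$, and suppose that $$P(Y_{n,t}\le y\mid\Omega_{nt})=G_{nt}(y\mid\Omega_{nt},\theta_n)\quad\text{a.s.},\qquad 1\le t\le n,\ y\in\mathbb R,$$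 where conditioning on $\Omega_{nt}$ inside a distribution function means inserting $x=(Y_{n,t-1},Y_{n,t-2},\dots)$; this argument is dropped below. Let $\hat\theta=\hat\theta_n$ be a $\Theta$-valued estimator with $\sqrt n\,\|\hat\theta-\theta_n\|=O_p(1)$. For $r\in[0,1]$ and $u\in\Theta$ put $$\eta_t(r,u)=G_{nt}\bigl(F_t^{-1}(r\mid u)\mid\theta_n\bigr),\qquad \eta_t(r)=\eta_t(r,\hat\theta),$$ with $F_t^{-1}(0\mid u)=-\infty$, $F_t^{-1}(1\mid u)=+\infty$, $G_{nt}(-\infty\mid\theta_n)=0$, $G_{nt}(+\infty\mid\theta_n)=1$. Let $\hat U_t=F_t(Y_{n,t}\mid\hat\theta)$, $U_t^\dagger=G_{nt}(Y_{n,t}\mid\theta_n)$ and, for $r=(r_1,r_2)\in[0,1]^2$, $$V_{2n}(r)=\frac1{\sqrt{n-1}}\sum_{t=2}^n\bigl[I(U_t^\dagger\le r_1)I(U_{t-1}^\dagger\le r_2)-r_1r_2\bigr],$$ $$\hat V_{2n}(r)=\frac1{\sqrt{n-1}}\sum_{t=2}^n\bigl[I(\hat U_t\le r_1)I(\hat U_{t-1}\le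 r_2)-r_1r_2\bigr],$$ $$k_n(r)=\frac1{\sqrt n}\sum_{t=2}^n\Bigl[I\bigl(U^\dagger_{t-1}\le\eta_{t-1}(r_2)\bigr)\bigl(\eta_t(r_1)-r_1\bigr)+r_1\bigl(\eta_{t-1}(r_2)-r_2\bigr)\Bigr].$$ \textbf{Conditions.} Let $B(\theta_n,\rho)$ be the set of $u\in\Theta$ with $\|u-\theta_n\|<\rho$. (C1) $\displaystyle\sup_{r\in[0,1],\,1\le t\le n}|\eta_t(r)-r|=O_p(n^{-1/2})$. (C2) For all $M,M_2\in(0,\infty)$ and $\kappa>0$, $$\sup_{r\in[0,1]}\frac1{\sqrt n}\sum_{t=1}^n\ \sup_{\substack{u,v\in B(\theta_n,Mn^{-1/2})\\ \|u-v\|\le M_2n^{-1/2-\kappa}}}|\eta_t(r,u)-\eta_t(r,v)|=o_p(1).$$ (C3) For all $M,M_2\in(0,\infty)$ and $\kappa>0$, $$\sup_{\substack{r,s\in[0,1]\\ |r-s|\le M_2n^{-1/2-\kappa}}}\frac1{\sqrt n}\sum_{t=1}^n\ \sup_{u\in B(\theta_n,Mn^{-1/2})}|\eta_t(r,u)-\eta_t(s,u)|=o_p(1).$$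 \textbf{Claim.} Under (C1)--(C3), $$\sup_{r\in[0,1]^2}\bigl|\hat V_{2n}(r)-V_{2n}(r)-k_n(r)\bigr|=o_p(1).$$ Here $O_p$ and $o_p$ are understood in the sense of outer probability where a quantity is not measurable. -/

import Mathlib

open MeasureTheory Filter Topology
open scoped ENNReal

noncomputable section

namespace SpecTest

/-- `X n = o_p(1)` for nonnegative (possibly infinite) random variables `X n` on `(Ω n, P n)`. -/
def IsLittleOP {Ω : ℕ → Type*} [∀ n, MeasurableSpace (Ω n)] (P : ∀ n, Measure (Ω n))
    (X : ∀ n, Ω n → ℝ≥0∞) : Prop :=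
  ∀ ε : ℝ, 0 < ε → Tendsto (fun n => P n {ω | ENNReal.ofReal ε < X n ω}) atTop (𝓝 0)

/-- `X n = O_p(a n)` for nonnegative (possibly infinite) random variables `X n` on `(Ω n, P n)`. -/
def IsBigOP {Ω : ℕ → Type*} [∀ n, MeasurableSpace (Ω n)] (P : ∀ n, Measure (Ω n))
    (X : ∀ n, Ω n → ℝ≥0∞) (a : ℕ → ℝ) : Prop :=
  ∀ ε : ℝ, 0 < ε → ∃ K : ℝ, ∀ᶠ n in atTop,
    P n {ω | ENNReal.ofReal (K * a n) < X n ω} ≤ ENNReal.ofReal ε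

/-- A continuous and strictly increasing cumulative distribution function on the line. -/
structure IsStrictCDF (F : ℝ → ℝ) : Prop where
  continuous : Continuous F
  strictMono : StrictMono F
  atBot : Tendsto F atBot (𝓝 0)
  atTop : Tendsto F atTop (𝓝 1)

/-- A distribution function evaluated on the extended line: `F (-∞) = 0` and `F (+∞) = 1`. -/
def extCDF (F : ℝ → ℝ) (y : EReal) : ℝ :=
  if y = ⊥ then 0 else if y = ⊤ then 1 else F y.toReal

/-- The quantile function `F⁻¹(r) = inf {y ∈ [-∞, ∞] : r ≤ F y}`; for a continuous strictly
increasing `F` it is the inverse of `F` on `(0,1)`, with `F⁻¹(0) = -∞` and `F⁻¹(1) = +∞`. -/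
def quantile (F : ℝ → ℝ) (r : ℝ) : EReal := sInf {y : EReal | r ≤ extCDF F y}

/-- The past `(Y_{t-1}, Y_{t-2}, …)` of a time series at time `t`. -/
def past {Ω : Type*} (Y : ℤ → Ω → ℝ) (t : ℤ) (ω : Ω) : ℕ → ℝ := fun k => Y (t - 1 - k) ω

/-- The information set at time `t`: the σ-field generated by `Y_{t-1}, Y_{t-2}, …`. -/
abbrev info {Ω : Type*} (Y : ℤ → Ω → ℝ) (t : ℤ) : MeasurableSpace Ω :=
  MeasurableSpace.comap (past Y t) inferInstance

variable {Θ : Type*}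

/-- The conditional distribution function
`G_{nt}(y | x, θ) = (1 - δ/√n) F_t(y | x, θ) + (δ/√n) H_t(y | x)`, where `x` is the past. -/
def mixCDF (F : ℤ → (ℕ → ℝ) → Θ → ℝ → ℝ) (H : ℤ → (ℕ → ℝ) → ℝ → ℝ) (δ : ℝ) (n : ℕ)
    (t : ℤ) (x : ℕ → ℝ) (θ : Θ) (y : ℝ) : ℝ :=
  (1 - δ / √(n : ℝ)) * F t x θ y + δ / √(n : ℝ) * H t x y

/-- `η_t(r, u) = G_{nt}(F_t⁻¹(r | x, u) | x, θ)`, where `x` is the past and `θ` the true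
parameter. -/
def eta (F : ℤ → (ℕ → ℝ) → Θ → ℝ → ℝ) (H : ℤ → (ℕ → ℝ) → ℝ → ℝ) (δ : ℝ) (n : ℕ) (θ : Θ)
    (t : ℤ) (x : ℕ → ℝ) (r : ℝ) (u : Θ) : ℝ :=
  extCDF (mixCDF F H δ n t x θ) (quantile (F t x u) r)

/-- The indicator `I(a ≤ b)`. -/
def ind (a b : ℝ) : ℝ := if a ≤ b then 1 else 0

/-- The bi-parameter empirical process of a series `U_1, …, U_n`:
`(n-1)^{-1/2} ∑_{t=2}^n [I(U_t ≤ r₁) I(U_{t-1} ≤ r₂) - r₁ r₂]`. -/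
def empProc (n : ℕ) (U : ℤ → ℝ) (r₁ r₂ : ℝ) : ℝ :=
  1 / √((n : ℝ) - 1) *
    ∑ t ∈ Finset.Icc (2 : ℤ) n, (ind (U t) r₁ * ind (U (t - 1)) r₂ - r₁ * r₂)

/-- The drift `n^{-1/2} ∑_{t=2}^n [I(U_{t-1} ≤ η_{t-1}(r₂)) (η_t(r₁) - r₁)
+ r₁ (η_{t-1}(r₂) - r₂)]`. -/
def drift (n : ℕ) (U : ℤ → ℝ) (η : ℤ → ℝ → ℝ) (r₁ r₂ : ℝ) : ℝ :=
  1 / √(n : ℝ) *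
    ∑ t ∈ Finset.Icc (2 : ℤ) n,
      (ind (U (t - 1)) (η (t - 1) r₂) * (η t r₁ - r₁) + r₁ * (η (t - 1) r₂ - r₂))

end SpecTest

end

open SpecTest

open SpecTest

/-! Both transforms are increasing in `Y_t`, so `Û_t ≤ r` is the event `U†_t ≤ η_t(r)`: the
estimated process is the empirical process of the `U†_t` at moved levels, and `U†_t` is uniform
given the past. Centring leaves the drift plus sums of `I(U†_{t-1} ≤ y_{t-1}) (I(U†_t ≤ x_t) -
x_t)`, compared at the levels `η(r)` and `r`, whose total distance is O(√n) by (C1). For predictable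
levels such a comparison is a martingale with conditional variance O(√n), so a Freedman bound
(`measure_lt_sum_indIncr_le`) lets it exceed ε√n only with probability of order exp(-c√n).

The obstacle is that `η_t(r)` contains the estimator, which sees the whole sample and destroys
predictability. The ball of radius M/√n is therefore cut into polynomially many cells of diameter at
most 1/n, and [0,1] into n intervals. Infima and suprema of `η_t` over a cell at the grid ends
depend on the past only and bracket `η_t(r)`; (C2) and (C3) with κ = 1/2 make the total width at
most ε√n. Monotonicity of indicators carries brackets of levels over to the sums
(`SmallSums.abs_sum_sub_le`), an algebraic decomposition gives the expansion
(`SmallSums.abs_empProc_sub_le`), and a union bound over pairs and quadruples of levels is beaten by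
exp(-c√n) (`measure_expansion_error_le`).

A supremum over a cell need not be Borel in the past, but its superlevel sets are analytic, hence
universally measurable; it thus has a version measurable for the past, which is enough. -/

/-! ### Universal measurability of analytic sets and of suprema over parameters -/

lemma isCompact_setOf_forall_le (k : ℕ → ℕ) : IsCompact {x : ℕ → ℕ | ∀ i, x i ≤ k i} := by
  have : {x : ℕ → ℕ | ∀ i, x i ≤ k i} = Set.pi Set.univ (fun i => Set.Iic (k i)) := by
    ext x; simp only [Set.mem_pi, Set.mem_univ, true_imp_iff, Set.mem_Iic]; rfl
  rw [this]
  exact isCompact_univ_pi fun i => (Set.finite_Iic (k i)).isCompact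

/-- A neighbourhood of a product of initial segments of `ℕ` contains a cylinder over it. -/
lemma exists_forall_lt_le_subset_of_isOpen {k : ℕ → ℕ} {V : Set (ℕ → ℕ)} (hV : IsOpen V)
    (hk : {x : ℕ → ℕ | ∀ i, x i ≤ k i} ⊆ V) :
    ∃ m : ℕ, {x : ℕ → ℕ | ∀ i < m, x i ≤ k i} ⊆ V := by
  by_contra! hcon
  have hcon' : ∀ m : ℕ, ∃ x : ℕ → ℕ, (∀ i < m, x i ≤ k i) ∧ x ∉ V := by
    intro m
    obtain ⟨x, hx, hxV⟩ := Set.not_subset.1 (hcon m)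
    exact ⟨x, hx, hxV⟩
  choose x hx hxV using hcon'
  have hK : IsCompact {x : ℕ → ℕ | ∀ i, x i ≤ k i} := isCompact_setOf_forall_le k
  -- Truncation at `k` moves the bad points into the compact box and leaves coordinate `i` unchanged
  -- once `m > i`, so the bad points share the subsequential limit.
  obtain ⟨y, hyK, φ, hφ, hlim⟩ := hK.tendsto_subseq (x := fun m i => min (x m i) (k i))
    (fun m i => min_le_right _ _)
  have hlim' : Tendsto (fun m => x (φ m)) atTop (𝓝 y) := by
    rw [tendsto_pi_nhds] at hlim ⊢
    intro i
    refine (hlim i).congr' ?_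
    filter_upwards [eventually_gt_atTop i] with m hm
    exact min_eq_left (hx (φ m) i (lt_of_lt_of_le hm (hφ.id_le m)))
  obtain ⟨m, hm⟩ := (hlim'.eventually (hV.mem_nhds (hk hyK))).exists
  exact hxV _ hm

/-- The image of the Baire space under a continuous map is inner regular for compact sets. -/
lemma exists_isCompact_subset_range_lt_measure {α : Type*} [TopologicalSpace α] [T2Space α]
    [MeasurableSpace α] [OpensMeasurableSpace α] (μ : Measure α) [IsFiniteMeasure μ]
    {f : (ℕ → ℕ) → α} (hf : Continuous f) {a : ℝ≥0∞} (ha : a < μ (Set.range f)) :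
    ∃ K ⊆ Set.range f, IsCompact K ∧ a ≤ μ K := by
  -- By continuity from below, one more coordinate can be bounded without the measure of the image
  -- dropping to `a`.
  have hstep : ∀ (D : {D : Set (ℕ → ℕ) // a < μ (f '' D)}) (m : ℕ),
      ∃ N : ℕ, a < μ (f '' (D.1 ∩ {x | x m ≤ N})) := by
    rintro ⟨D, hD⟩ m
    have hU : f '' D = ⋃ N : ℕ, f '' (D ∩ {x | x m ≤ N}) := by
      rw [← Set.image_iUnion, ← Set.inter_iUnion]
      congr 1
      refine (Set.inter_eq_left.2 fun x _ => Set.mem_iUnion.2 ⟨x m, le_refl (x m)⟩).symm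
    have hmono : Monotone fun N : ℕ => f '' (D ∩ {x | x m ≤ N}) := by
      intro N N' hN
      refine Set.image_mono (Set.inter_subset_inter_right _ fun x hx => ?_)
      exact le_trans hx hN
    rw [hU, hmono.measure_iUnion] at hD
    exact lt_iSup_iff.1 hD
  choose g hg using hstep
  let S : ℕ → {D : Set (ℕ → ℕ) // a < μ (f '' D)} := fun m =>
    Nat.rec ⟨Set.univ, by rwa [Set.image_univ]⟩ (fun m D => ⟨_, hg D m⟩) m
  let k : ℕ → ℕ := fun m => g (S m) m
  have hS : ∀ m, (S m).1 = {x : ℕ → ℕ | ∀ i < m, x i ≤ k i} := by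
    intro m
    induction m with
    | zero => ext x; simp [S]
    | succ m ih =>
      have : (S (m + 1)).1 = (S m).1 ∩ {x | x m ≤ k m} := rfl
      rw [this, ih]
      ext x
      simp only [Set.mem_inter_iff, Set.mem_ofPred_eq, Nat.lt_succ_iff]
      constructor
      · rintro ⟨h1, h2⟩ i hi
        rcases hi.lt_or_eq with h | rfl
        · exact h1 i h
        · exact h2
      · intro h
        exact ⟨fun i hi => h i hi.le, h m le_rfl⟩
  have hKc : IsCompact {x : ℕ → ℕ | ∀ i, x i ≤ k i} := isCompact_setOf_forall_le k
  have hfK := hKc.image hf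
  refine ⟨f '' {x : ℕ → ℕ | ∀ i, x i ≤ k i}, Set.image_subset_range _ _, hfK, ?_⟩
  -- A point off the compact image is separated from it by open sets, and the preimage of the one
  -- around the image contains some `S m`. Closures appear because the images of the `S m` are not
  -- known to be measurable.
  have hsub : (⋂ m, closure (f '' (S m).1)) ⊆ f '' {x : ℕ → ℕ | ∀ i, x i ≤ k i} := by
    intro y hy
    by_contra hyK
    obtain ⟨O, O', hO, hO', hKO, hyO', hdisj⟩ :=
      hfK.separation_of_notMem hyK
    obtain ⟨m, hm⟩ := exists_forall_lt_le_subset_of_isOpen (k := k) (hO.preimage hf)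
      (Set.image_subset_iff.1 hKO)
    have h1 : y ∈ closure (f '' (S m).1) := Set.mem_iInter.1 hy m
    obtain ⟨z, hz, hz'⟩ := mem_closure_iff.1 h1 O' hO' hyO'
    rw [hS m] at hz'
    exact Set.disjoint_left.1 hdisj (Set.image_subset_iff.2 hm hz') hz
  refine le_trans ?_ (measure_mono hsub)
  have hanti : Antitone fun m => closure (f '' (S m).1) := by
    intro m m' hmm
    refine closure_mono (Set.image_mono ?_)
    rw [hS, hS]
    exact fun x hx i hi => hx i (lt_of_lt_of_le hi hmm)
  rw [hanti.measure_iInter (fun m => isClosed_closure.measurableSet.nullMeasurableSet)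
    ⟨0, measure_ne_top _ _⟩]
  exact le_iInf fun m => (S m).2.le.trans (measure_mono subset_closure)

/-- Analytic sets are universally measurable. -/
theorem MeasureTheory.AnalyticSet.nullMeasurableSet {α : Type*} [TopologicalSpace α] [T2Space α]
    [MeasurableSpace α] [OpensMeasurableSpace α] {s : Set α} (hs : AnalyticSet s)
    (μ : Measure α) [IsFiniteMeasure μ] : NullMeasurableSet s μ := by
  rw [AnalyticSet] at hs
  rcases hs with rfl | ⟨f, hf, rfl⟩
  · exact nullMeasurableSet_empty
  rcases eq_or_ne (μ (Set.range f)) 0 with h0 | h0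
  · exact NullMeasurableSet.of_null h0
  obtain ⟨u, -, hu, hlim⟩ := exists_seq_strictMono_tendsto' (pos_iff_ne_zero.2 h0)
  choose K hKs hKc hK using fun n => exists_isCompact_subset_range_lt_measure μ hf (hu n).2
  have hT : MeasurableSet (⋃ n, K n) := MeasurableSet.iUnion fun n => (hKc n).measurableSet
  refine hT.nullMeasurableSet.congr (ae_eq_of_subset_of_measure_ge (Set.iUnion_subset hKs) ?_
    hT.nullMeasurableSet (measure_ne_top _ _))
  exact le_of_tendsto' hlim fun n => (hK n).trans (measure_mono (Set.subset_iUnion K n))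

/-- A supremum of a jointly measurable function over a measurable set of parameters is
universally measurable. -/
theorem aemeasurable_iSup_of_measurable_prod {X T : Type*} [TopologicalSpace X] [PolishSpace X]
    [MeasurableSpace X] [BorelSpace X] [MeasurableSpace T] [StandardBorelSpace T]
    (μ : Measure X) [IsFiniteMeasure μ] {g : X × T → ℝ} (hg : Measurable g) {C : Set T}
    (hC : MeasurableSet C) (hne : C.Nonempty)
    (hbdd : ∀ x, BddAbove (Set.range fun u : C => g (x, u))) :
    AEMeasurable (fun x => ⨆ u : C, g (x, u)) μ := by
  have : Nonempty C := hne.to_subtype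
  refine NullMeasurable.aemeasurable (μ := μ) ?_
  suffices h : ∀ c : ℝ, NullMeasurableSet ((fun x => ⨆ u : C, g (x, u)) ⁻¹' Set.Ioi c) μ from
    measurable_of_Ioi (α := ℝ) (δ := NullMeasurableSpace X μ) h
  intro c
  -- Strict superlevel sets are projections of measurable sets, whether or not the supremum is
  -- attained.
  have hset : (fun x => ⨆ u : C, g (x, u)) ⁻¹' Set.Ioi c
      = Prod.fst '' {p : X × T | p.2 ∈ C ∧ c < g p} := by
    ext x
    simp only [Set.mem_preimage, Set.mem_Ioi, lt_ciSup_iff (hbdd x), Set.mem_image,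
      Set.mem_ofPred_eq, Prod.exists, exists_and_right, exists_eq_right, Subtype.exists,
      exists_prop]
  rw [hset]
  exact ((measurable_snd hC).inter (measurableSet_lt measurable_const hg)).analyticSet_image
    measurable_fst |>.nullMeasurableSet μ

theorem aemeasurable_iInf_of_measurable_prod {X T : Type*} [TopologicalSpace X] [PolishSpace X]
    [MeasurableSpace X] [BorelSpace X] [MeasurableSpace T] [StandardBorelSpace T]
    (μ : Measure X) [IsFiniteMeasure μ] {g : X × T → ℝ} (hg : Measurable g) {C : Set T}
    (hC : MeasurableSet C) (hne : C.Nonempty)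
    (hbdd : ∀ x, BddBelow (Set.range fun u : C => g (x, u))) :
    AEMeasurable (fun x => ⨅ u : C, g (x, u)) μ := by
  have h := (aemeasurable_iSup_of_measurable_prod μ hg.neg hC hne (fun x => by
    obtain ⟨b, hb⟩ := hbdd x
    refine ⟨-b, ?_⟩
    rintro _ ⟨u, rfl⟩
    exact neg_le_neg (hb ⟨u, rfl⟩))).neg
  refine h.congr (Eventually.of_forall fun x => ?_)
  simp only [Pi.neg_apply, iInf, iSup]
  rw [show (Set.range fun u : C => -g (x, u)) = -Set.range (fun u : C => g (x, u)) from ?_,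
    Real.sSup_neg, neg_neg]
  ext y
  simp [neg_eq_iff_eq_neg]

/-! ### Indicators and weighted centred increments -/

lemma ind_nonneg (a b : ℝ) : 0 ≤ ind a b := by unfold ind; split_ifs <;> norm_num

lemma ind_le_one (a b : ℝ) : ind a b ≤ 1 := by unfold ind; split_ifs <;> norm_num

lemma ind_mono (x : ℝ) {a b : ℝ} (h : a ≤ b) : ind x a ≤ ind x b := by
  unfold ind
  split_ifs with h1 h2
  · exact le_rfl
  · exact absurd (h1.trans h) h2
  · exact zero_le_one
  · exact le_rfl

lemma ind_congr {a b c d : ℝ} (h : a ≤ b ↔ c ≤ d) : ind a b = ind c d := by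
  unfold ind; simp only [h]

lemma abs_ind_sub_ind (x a b : ℝ) :
    |ind x a - ind x b| = ind x (max a b) - ind x (min a b) := by
  rcases le_total a b with h | h
  · rw [max_eq_right h, min_eq_left h, abs_sub_comm, abs_of_nonneg (sub_nonneg.2 (ind_mono x h))]
  · rw [max_eq_left h, min_eq_right h, abs_of_nonneg (sub_nonneg.2 (ind_mono x h))]

/-- Makes the square linear in indicators, so that its mean can be read off the distribution
function. -/
lemma sq_ind_sub_ind (x a b : ℝ) :
    (ind x a - ind x b) ^ 2 = ind x (max a b) - ind x (min a b) := by
  rw [← abs_ind_sub_ind]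
  unfold ind
  split_ifs <;> norm_num

lemma measurable_ind : Measurable fun p : ℝ × ℝ => ind p.1 p.2 :=
  Measurable.ite (measurableSet_le measurable_fst measurable_snd) measurable_const measurable_const

lemma Measurable.ind {Ω : Type*} {m : MeasurableSpace Ω} {f g : Ω → ℝ} (hf : Measurable f)
    (hg : Measurable g) : Measurable fun ω => SpecTest.ind (f ω) (g ω) :=
  measurable_ind.comp (hf.prodMk hg)

/-- The difference `w (I(x ≤ a) - a) - w' (I(x ≤ b) - b)` of weighted centred indicators. -/
noncomputable def indIncr (x w w' a b : ℝ) : ℝ := w * (ind x a - a) - w' * (ind x b - b)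

lemma indIncr_swap (x w w' a b : ℝ) : indIncr x w' w b a = -indIncr x w w' a b := by
  unfold indIncr; ring

/-- The variation proxy of `indIncr`. -/
def incrVar (w w' a b : ℝ) : ℝ := |w - w'| + |a - b|

lemma incrVar_swap (w w' a b : ℝ) : incrVar w' w b a = incrVar w w' a b := by
  unfold incrVar; rw [abs_sub_comm w', abs_sub_comm b]

lemma Measurable.indIncr {Ω : Type*} {m : MeasurableSpace Ω} {x w w' a b : Ω → ℝ}
    (hx : Measurable x) (hw : Measurable w) (hw' : Measurable w') (ha : Measurable a)
    (hb : Measurable b) : Measurable fun ω => _root_.indIncr (x ω) (w ω) (w' ω) (a ω) (b ω) :=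
  (hw.mul ((hx.ind ha).sub ha)).sub (hw'.mul ((hx.ind hb).sub hb))

lemma Measurable.incrVar {Ω : Type*} {m : MeasurableSpace Ω} {w w' a b : Ω → ℝ}
    (hw : Measurable w) (hw' : Measurable w') (ha : Measurable a)
    (hb : Measurable b) : Measurable fun ω => _root_.incrVar (w ω) (w' ω) (a ω) (b ω) :=
  (continuous_abs.measurable.comp (hw.sub hw')).add (continuous_abs.measurable.comp (ha.sub hb))

/-! ### Conditional exponential moment of one increment -/

section Exponential

variable {ν : Measure ℝ} [IsProbabilityMeasure ν]

lemma integrable_ind (a : ℝ) : Integrable (fun x => ind x a) ν :=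
  Integrable.of_bound (measurable_id.ind measurable_const).aestronglyMeasurable 1
    (Eventually.of_forall fun x => by
      rw [Real.norm_eq_abs, abs_of_nonneg (ind_nonneg _ _)]; exact ind_le_one _ _)

lemma integral_ind {ν : Measure ℝ} {a : ℝ} (ha : 0 ≤ a) (h : ν (Set.Iic a) = ENNReal.ofReal a) :
    ∫ x, ind x a ∂ν = a := by
  have : (fun x => ind x a) = (Set.Iic a).indicator fun _ => (1 : ℝ) := by
    ext x; simp [ind, Set.indicator]
  rw [this, integral_indicator measurableSet_Iic, setIntegral_const, measureReal_def, h]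
  simp [ha]

/-- Since the exponent is at most 1 in absolute value, e^y ≤ 1 + y + y² applies; the square is
bounded through the splitting (w - w')(I_a - a) + w'((I_a - I_b) - (a - b)). The bound is affine in
four indicators, so it can be integrated exactly. -/
lemma exp_indIncr_le {x w w' a b l : ℝ} (hw : w ∈ Set.Icc (0 : ℝ) 1) (hw' : w' ∈ Set.Icc (0 : ℝ) 1)
    (ha : a ∈ Set.Icc (0 : ℝ) 1) (hb : b ∈ Set.Icc (0 : ℝ) 1) (hl : 0 ≤ l) (hl' : l ≤ 1 / 2) :
    Real.exp (l * indIncr x w w' a b) ≤ 1 + l * indIncr x w w' a b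
      + l ^ 2 * (2 * |w - w'| + 2 * (ind x (max a b) - ind x (min a b)
        - 2 * (a - b) * (ind x a - ind x b) + (a - b) ^ 2)) := by
  have h0a := ind_nonneg x a
  have h1a := ind_le_one x a
  have h0b := ind_nonneg x b
  have h1b := ind_le_one x b
  have hA : |ind x a - a| ≤ 1 := abs_le.2 ⟨by linarith [ha.2], by linarith [ha.1]⟩
  have hB : |ind x b - b| ≤ 1 := abs_le.2 ⟨by linarith [hb.2], by linarith [hb.1]⟩
  have hwA : |w * (ind x a - a)| ≤ 1 := by
    rw [abs_mul, abs_of_nonneg hw.1]; exact mul_le_one₀ hw.2 (abs_nonneg _) hA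
  have hwB : |w' * (ind x b - b)| ≤ 1 := by
    rw [abs_mul, abs_of_nonneg hw'.1]; exact mul_le_one₀ hw'.2 (abs_nonneg _) hB
  have hX : |indIncr x w w' a b| ≤ 2 := by
    unfold indIncr
    exact (abs_sub _ _).trans (by linarith)
  have hlX : |l * indIncr x w w' a b| ≤ 1 := by
    rw [abs_mul, abs_of_nonneg hl]
    nlinarith [abs_nonneg (indIncr x w w' a b)]
  have h1 := (abs_le.1 (Real.abs_exp_sub_one_sub_id_le hlX)).2
  have h2 : indIncr x w w' a b ^ 2 ≤ 2 * |w - w'| + 2 * (ind x (max a b) - ind x (min a b)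
        - 2 * (a - b) * (ind x a - ind x b) + (a - b) ^ 2) := by
    rw [← sq_ind_sub_ind]
    have e : indIncr x w w' a b
        = (w - w') * (ind x a - a) + w' * ((ind x a - ind x b) - (a - b)) := by
      unfold indIncr; ring
    have hsq : ∀ p q : ℝ, (p + q) ^ 2 ≤ 2 * p ^ 2 + 2 * q ^ 2 := fun p q => by
      nlinarith [sq_nonneg (p - q)]
    rw [e]
    refine (hsq _ _).trans ?_
    have i1 : ((w - w') * (ind x a - a)) ^ 2 ≤ |w - w'| := by
      rw [← sq_abs, abs_mul]
      have hd : |w - w'| ≤ 1 := abs_le.2 ⟨by linarith [hw.1, hw'.2], by linarith [hw.2, hw'.1]⟩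
      have hp : |w - w'| * |ind x a - a| ≤ |w - w'| :=
        mul_le_of_le_one_right (abs_nonneg _) hA
      have hp0 : 0 ≤ |w - w'| * |ind x a - a| := by positivity
      nlinarith
    have i2 : (w' * ((ind x a - ind x b) - (a - b))) ^ 2 ≤ ((ind x a - ind x b) - (a - b)) ^ 2 := by
      rw [mul_pow]
      exact mul_le_of_le_one_left (sq_nonneg _) (pow_le_one₀ hw'.1 hw'.2)
    nlinarith
  nlinarith [mul_le_mul_of_nonneg_left h2 (sq_nonneg l)]

/-- The conditional exponential moment of an increment. -/
lemma lintegral_exp_indIncr_le (hν : ∀ s ∈ Set.Icc (0 : ℝ) 1, ν (Set.Iic s) = ENNReal.ofReal s)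
    {w w' a b l : ℝ} (hw : w ∈ Set.Icc (0 : ℝ) 1) (hw' : w' ∈ Set.Icc (0 : ℝ) 1)
    (ha : a ∈ Set.Icc (0 : ℝ) 1) (hb : b ∈ Set.Icc (0 : ℝ) 1) (hl : 0 ≤ l) (hl' : l ≤ 1 / 2) :
    ∫⁻ x, ENNReal.ofReal (Real.exp (l * indIncr x w w' a b)) ∂ν
      ≤ ENNReal.ofReal (Real.exp (2 * l ^ 2 * incrVar w w' a b)) := by
  have hM : max a b ∈ Set.Icc (0 : ℝ) 1 := ⟨le_max_of_le_left ha.1, max_le ha.2 hb.2⟩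
  have hm : min a b ∈ Set.Icc (0 : ℝ) 1 := ⟨le_min ha.1 hb.1, min_le_of_left_le ha.2⟩
  have key : ∀ c ∈ Set.Icc (0 : ℝ) 1, ∫ x, ind x c ∂ν = c := fun c hc =>
    integral_ind hc.1 (hν c hc)
  set p : ℝ := l * w - 4 * l ^ 2 * (a - b)
  set q : ℝ := -(l * w') + 4 * l ^ 2 * (a - b)
  set c : ℝ := 1 - l * w * a + l * w' * b + l ^ 2 * (2 * |w - w'| + 2 * (a - b) ^ 2)
  have hlin : ∀ x, 1 + l * indIncr x w w' a b
      + l ^ 2 * (2 * |w - w'| + 2 * (ind x (max a b) - ind x (min a b)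
        - 2 * (a - b) * (ind x a - ind x b) + (a - b) ^ 2))
      = p * ind x a + q * ind x b + 2 * l ^ 2 * ind x (max a b)
        + (-(2 * l ^ 2)) * ind x (min a b) + c := by
    intro x; simp only [indIncr, p, q, c]; ring
  have hi1 := (integrable_ind (ν := ν) a).const_mul p
  have hi2 := (integrable_ind (ν := ν) b).const_mul q
  have hi3 := (integrable_ind (ν := ν) (max a b)).const_mul (2 * l ^ 2)
  have hi4 := (integrable_ind (ν := ν) (min a b)).const_mul (-(2 * l ^ 2))
  have hint := (((hi1.add hi2).add hi3).add hi4).add (integrable_const (μ := ν) c)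
  calc ∫⁻ x, ENNReal.ofReal (Real.exp (l * indIncr x w w' a b)) ∂ν
      ≤ ∫⁻ x, ENNReal.ofReal (p * ind x a + q * ind x b + 2 * l ^ 2 * ind x (max a b)
        + (-(2 * l ^ 2)) * ind x (min a b) + c) ∂ν := by
        refine lintegral_mono fun x => ENNReal.ofReal_le_ofReal ?_
        rw [← hlin]
        exact exp_indIncr_le hw hw' ha hb hl hl'
    _ = ENNReal.ofReal (∫ x, (p * ind x a + q * ind x b + 2 * l ^ 2 * ind x (max a b)
        + (-(2 * l ^ 2)) * ind x (min a b) + c) ∂ν) := by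
        refine (ofReal_integral_eq_lintegral_ofReal hint (Eventually.of_forall fun x => ?_)).symm
        refine le_trans (Real.exp_pos (l * indIncr x w w' a b)).le ?_
        refine (exp_indIncr_le hw hw' ha hb hl hl').trans (hlin x).le
    _ ≤ _ := by
        refine ENNReal.ofReal_le_ofReal ?_
        have e : ∫ x, (p * ind x a + q * ind x b + 2 * l ^ 2 * ind x (max a b)
            + (-(2 * l ^ 2)) * ind x (min a b) + c) ∂ν
            = p * a + q * b + 2 * l ^ 2 * max a b + (-(2 * l ^ 2)) * min a b + c := by
          have e1 := integral_add (((hi1.add hi2).add hi3).add hi4) (integrable_const (μ := ν) c)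
          have e2 := integral_add ((hi1.add hi2).add hi3) hi4
          have e3 := integral_add (hi1.add hi2) hi3
          have e4 := integral_add hi1 hi2
          simp only [Pi.add_apply] at e1 e2 e3 e4
          rw [e1, e2, e3, e4]
          simp only [integral_const_mul, key a ha, key b hb, key _ hM, key _ hm]
          simp
        rw [e]
        -- The mean is 1 + 2l²(|w - w'| + |a - b| - (a - b)²), and the last square is dropped.
        refine le_trans ?_ (Real.add_one_le_exp _)
        have habs : |a - b| = max a b - min a b := (max_sub_min_eq_abs' a b).symm
        simp only [p, q, c, incrVar, habs]
        nlinarith [sq_nonneg (l * (a - b))]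

end Exponential

/-! ### Conditional uniformity, exponential supermartingale and Freedman inequality -/

/-- `U` is uniform on `[0, 1]` given the σ-field `m`. -/
def IsUniformGiven {Ω : Type*} {m0 : MeasurableSpace Ω} (P : Measure Ω) (m : MeasurableSpace Ω)
    (U : Ω → ℝ) : Prop :=
  ∀ A, MeasurableSet[m] A → ∀ s ∈ Set.Icc (0 : ℝ) 1,
    P (A ∩ {ω | U ω ≤ s}) = P A * ENNReal.ofReal s

section Martingale

variable {Ω : Type*} {m m0 : MeasurableSpace Ω} {P : Measure Ω} [IsProbabilityMeasure P]

lemma IsUniformGiven.map_Iic {U : Ω → ℝ} (h : IsUniformGiven P m U)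
    (hU : Measurable U) : ∀ s ∈ Set.Icc (0 : ℝ) 1, P.map U (Set.Iic s) = ENNReal.ofReal s := by
  intro s hs
  have := h Set.univ MeasurableSet.univ s hs
  rw [Set.univ_inter, measure_univ, one_mul] at this
  rw [Measure.map_apply hU measurableSet_Iic, ← this]
  rfl

lemma IsUniformGiven.measure_inter_Iic {P : Measure Ω} {U : Ω → ℝ}
    (h : IsUniformGiven P m U) {A : Set Ω} (hA : MeasurableSet[m] A) (s : ℝ) :
    P (A ∩ {ω | U ω ≤ s}) = P A * ENNReal.ofReal (min s 1) := by
  rcases lt_or_ge s 0 with hs | hs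
  · rw [ENNReal.ofReal_of_nonpos ((min_le_left _ _).trans hs.le), mul_zero]
    have := h A hA 0 ⟨le_rfl, zero_le_one⟩
    rw [ENNReal.ofReal_zero, mul_zero] at this
    exact measure_mono_null (Set.inter_subset_inter_right _ fun ω hω => le_trans hω hs.le) this
  rcases le_total s 1 with hs1 | hs1
  · rw [min_eq_left hs1]; exact h A hA s ⟨hs, hs1⟩
  · rw [min_eq_right hs1]
    have := h A hA 1 ⟨zero_le_one, le_rfl⟩
    refine le_antisymm ?_ ?_
    · simpa using measure_mono Set.inter_subset_left
    · rw [← this]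
      exact measure_mono (Set.inter_subset_inter_right _ fun ω hω => le_trans hω hs1)

/-- On an event of `m` the law of `U` is a multiple of its unconditional law, since half-lines
determine a finite measure. Independence allows the newest observation to be integrated out with all
predictable quantities frozen. -/
lemma IsUniformGiven.indepFun {U : Ω → ℝ}
    (h : IsUniformGiven P m U) (hU : Measurable U) {E : Type*} [MeasurableSpace E] {T : Ω → E}
    (hT : Measurable[m] T) : ProbabilityTheory.IndepFun T U P := by
  rw [ProbabilityTheory.indepFun_iff_measure_inter_preimage_eq_mul]
  intro S B hS hB
  have hA : MeasurableSet[m] (T ⁻¹' S) := hT hS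
  have heq : (P.restrict (T ⁻¹' S)).map U = P (T ⁻¹' S) • P.map U := by
    have : IsFiniteMeasure (P (T ⁻¹' S) • P.map U) :=
      ⟨by simpa [Measure.smul_apply] using
        ENNReal.mul_lt_top (measure_lt_top _ _) (measure_lt_top _ _)⟩
    refine Measure.ext_of_Iic _ _ fun s => ?_
    rw [Measure.map_apply hU measurableSet_Iic, Measure.smul_apply,
      Measure.map_apply hU measurableSet_Iic, Measure.restrict_apply (hU measurableSet_Iic),
      Set.inter_comm, smul_eq_mul]
    have h1 := h.measure_inter_Iic hA s
    have h2 := h.measure_inter_Iic MeasurableSet.univ s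
    rw [Set.univ_inter, measure_univ, one_mul] at h2
    rw [← h2] at h1
    exact h1
  have := congrArg (fun ρ : Measure ℝ => ρ B) heq
  simp only [Measure.smul_apply, Measure.map_apply hU hB, Measure.restrict_apply (hU hB),
    smul_eq_mul] at this
  rw [Set.inter_comm]
  exact this

lemma lintegral_comp_prod_of_indepFun {E : Type*} [MeasurableSpace E] {T : Ω → E} {U : Ω → ℝ}
    (hT : Measurable T) (hU : Measurable U) (h : ProbabilityTheory.IndepFun T U P)
    {f : E × ℝ → ℝ≥0∞} (hf : Measurable f) :
    ∫⁻ ω, f (T ω, U ω) ∂P = ∫⁻ ω, ∫⁻ x, f (T ω, x) ∂(P.map U) ∂P := by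
  have : IsProbabilityMeasure (P.map U) := Measure.isProbabilityMeasure_map hU.aemeasurable
  rw [← lintegral_map hf (hT.prodMk hU),
    (ProbabilityTheory.indepFun_iff_map_prod_eq_prod_map_map hT.aemeasurable
      hU.aemeasurable).1 h, lintegral_prod _ hf.aemeasurable,
    lintegral_map hf.lintegral_prod_right' hT]

variable {ℱ : ℤ → MeasurableSpace Ω} {U : ℤ → Ω → ℝ} {w w' a b : ℤ → Ω → ℝ}

/-- The exponential supermartingale of a weighted difference of centred indicators. -/
lemma lintegral_exp_sum_indIncr_le (hle : ∀ t, ℱ t ≤ m0) (hmono : ∀ t, ℱ t ≤ ℱ (t + 1))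
    (hU : ∀ t, Measurable[ℱ (t + 1)] (U t)) {N : ℕ}
    (hunif : ∀ t ∈ Set.Icc (1 : ℤ) N, IsUniformGiven P (ℱ t) (U t))
    (hw : ∀ t, Measurable[ℱ t] (w t)) (hw' : ∀ t, Measurable[ℱ t] (w' t))
    (ha : ∀ t, Measurable[ℱ t] (a t)) (hb : ∀ t, Measurable[ℱ t] (b t))
    (hwI : ∀ t ω, w t ω ∈ Set.Icc (0 : ℝ) 1) (hwI' : ∀ t ω, w' t ω ∈ Set.Icc (0 : ℝ) 1)
    (haI : ∀ t ω, a t ω ∈ Set.Icc (0 : ℝ) 1) (hbI : ∀ t ω, b t ω ∈ Set.Icc (0 : ℝ) 1)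
    {l : ℝ} (hl : 0 ≤ l) (hl' : l ≤ 1 / 2) :
    ∫⁻ ω, ENNReal.ofReal (Real.exp (∑ t ∈ Finset.Icc (1 : ℤ) N,
      (l * indIncr (U t ω) (w t ω) (w' t ω) (a t ω) (b t ω)
        - 2 * l ^ 2 * incrVar (w t ω) (w' t ω) (a t ω) (b t ω)))) ∂P ≤ 1 := by
  have hmono' : Monotone ℱ := monotone_int_of_le_succ hmono
  induction N with
  | zero => simp
  | succ N ih =>
    have ih' := ih fun t ht => hunif t ⟨ht.1, ht.2.trans (by push_cast; linarith)⟩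
    refine le_trans ?_ ih'
    set s : ℤ := ((N + 1 : ℕ) : ℤ) with hs
    have hs' : s = (N : ℤ) + 1 := by rw [hs]; push_cast; ring
    have hIcc : Finset.Icc (1 : ℤ) s = insert s (Finset.Icc (1 : ℤ) N) := by
      ext t; simp only [Finset.mem_Icc, Finset.mem_insert]; omega
    have hnot : s ∉ Finset.Icc (1 : ℤ) N := by simp only [Finset.mem_Icc]; omega
    let S : Ω → ℝ := fun ω => ∑ t ∈ Finset.Icc (1 : ℤ) N,
      (l * indIncr (U t ω) (w t ω) (w' t ω) (a t ω) (b t ω)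
        - 2 * l ^ 2 * incrVar (w t ω) (w' t ω) (a t ω) (b t ω))
    have hS : Measurable[ℱ s] S := by
      refine Finset.measurable_fun_sum _ fun t ht => ?_
      have hts : t + 1 ≤ s := by rw [Finset.mem_Icc] at ht; omega
      have hts' : t ≤ s := by omega
      have m1 := (hU t).mono (hmono' hts) le_rfl
      have m2 := (hw t).mono (hmono' hts') le_rfl
      have m3 := (hw' t).mono (hmono' hts') le_rfl
      have m4 := (ha t).mono (hmono' hts') le_rfl
      have m5 := (hb t).mono (hmono' hts') le_rfl
      exact ((m1.indIncr m2 m3 m4 m5).const_mul l).sub ((m2.incrVar m3 m4 m5).const_mul _)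
    -- All that is known before time `s` forms one vector, so that a single application of Fubini
    -- integrates over `U s`.
    let T : Ω → ℝ × ℝ × ℝ × ℝ × ℝ := fun ω => (S ω, w s ω, w' s ω, a s ω, b s ω)
    have hT : Measurable[ℱ s] T := hS.prodMk ((hw s).prodMk ((hw' s).prodMk
      ((ha s).prodMk (hb s))))
    have hUs : Measurable (U s) := (hU s).mono (hle _) le_rfl
    have hun := hunif s ⟨by omega, le_rfl⟩
    have hind := hun.indepFun hUs hT
    let f : (ℝ × ℝ × ℝ × ℝ × ℝ) × ℝ → ℝ≥0∞ := fun p =>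
      ENNReal.ofReal (Real.exp (p.1.1 - 2 * l ^ 2 * incrVar p.1.2.1 p.1.2.2.1 p.1.2.2.2.1 p.1.2.2.2.2))
        * ENNReal.ofReal (Real.exp (l * indIncr p.2 p.1.2.1 p.1.2.2.1 p.1.2.2.2.1 p.1.2.2.2.2))
    have hf : Measurable f := by
      have c0 : Measurable fun p : (ℝ × ℝ × ℝ × ℝ × ℝ) × ℝ => p.1.1 := by fun_prop
      have c1 : Measurable fun p : (ℝ × ℝ × ℝ × ℝ × ℝ) × ℝ => p.1.2.1 := by fun_prop
      have c2 : Measurable fun p : (ℝ × ℝ × ℝ × ℝ × ℝ) × ℝ => p.1.2.2.1 := by fun_prop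
      have c3 : Measurable fun p : (ℝ × ℝ × ℝ × ℝ × ℝ) × ℝ => p.1.2.2.2.1 := by fun_prop
      have c4 : Measurable fun p : (ℝ × ℝ × ℝ × ℝ × ℝ) × ℝ => p.1.2.2.2.2 := by fun_prop
      exact (ENNReal.measurable_ofReal.comp (Real.measurable_exp.comp
        (c0.sub ((c1.incrVar c2 c3 c4).const_mul _)))).mul
        (ENNReal.measurable_ofReal.comp (Real.measurable_exp.comp
        ((measurable_snd.indIncr c1 c2 c3 c4).const_mul _)))
    have hν := hun.map_Iic hUs
    have : IsProbabilityMeasure (P.map (U s)) := Measure.isProbabilityMeasure_map hUs.aemeasurable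
    calc ∫⁻ ω, ENNReal.ofReal (Real.exp (∑ t ∈ Finset.Icc (1 : ℤ) s,
          (l * indIncr (U t ω) (w t ω) (w' t ω) (a t ω) (b t ω)
            - 2 * l ^ 2 * incrVar (w t ω) (w' t ω) (a t ω) (b t ω)))) ∂P
        = ∫⁻ ω, f (T ω, U s ω) ∂P := by
          refine lintegral_congr fun ω => ?_
          rw [hIcc, Finset.sum_insert hnot]
          simp only [f, T]
          rw [← ENNReal.ofReal_mul (Real.exp_pos _).le, ← Real.exp_add]
          congr 2
          simp only [S]
          ring
      _ = ∫⁻ ω, ∫⁻ x, f (T ω, x) ∂(P.map (U s)) ∂P :=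
          lintegral_comp_prod_of_indepFun (hT.mono (hle s) le_rfl) hUs hind hf
      _ ≤ ∫⁻ ω, ENNReal.ofReal (Real.exp (S ω)) ∂P := by
          refine lintegral_mono fun ω => ?_
          simp only [f, T]
          rw [lintegral_const_mul' _ _ ENNReal.ofReal_ne_top]
          refine (mul_le_mul_right (lintegral_exp_indIncr_le hν (hwI s ω) (hwI' s ω) (haI s ω)
            (hbI s ω) hl hl') _).trans ?_
          rw [← ENNReal.ofReal_mul (Real.exp_pos _).le, ← Real.exp_add, sub_add_cancel]

/-- A Freedman type inequality for weighted differences of centred indicators. -/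
lemma measure_lt_sum_indIncr_le (hle : ∀ t, ℱ t ≤ m0) (hmono : ∀ t, ℱ t ≤ ℱ (t + 1))
    (hU : ∀ t, Measurable[ℱ (t + 1)] (U t)) {N : ℕ}
    (hunif : ∀ t ∈ Set.Icc (1 : ℤ) N, IsUniformGiven P (ℱ t) (U t))
    (hw : ∀ t, Measurable[ℱ t] (w t)) (hw' : ∀ t, Measurable[ℱ t] (w' t))
    (ha : ∀ t, Measurable[ℱ t] (a t)) (hb : ∀ t, Measurable[ℱ t] (b t))
    (hwI : ∀ t ω, w t ω ∈ Set.Icc (0 : ℝ) 1) (hwI' : ∀ t ω, w' t ω ∈ Set.Icc (0 : ℝ) 1)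
    (haI : ∀ t ω, a t ω ∈ Set.Icc (0 : ℝ) 1) (hbI : ∀ t ω, b t ω ∈ Set.Icc (0 : ℝ) 1)
    {l : ℝ} (hl : 0 ≤ l) (hl' : l ≤ 1 / 2) (x v : ℝ) :
    P {ω | x < ∑ t ∈ Finset.Icc (1 : ℤ) N, indIncr (U t ω) (w t ω) (w' t ω) (a t ω) (b t ω)
        ∧ ∑ t ∈ Finset.Icc (1 : ℤ) N, incrVar (w t ω) (w' t ω) (a t ω) (b t ω) ≤ v}
      ≤ ENNReal.ofReal (Real.exp (-(l * x) + 2 * l ^ 2 * v)) := by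
  have h1 := lintegral_exp_sum_indIncr_le hle hmono hU hunif hw hw' ha hb hwI hwI' haI hbI hl hl'
  have hmeas : Measurable fun ω => ENNReal.ofReal (Real.exp (∑ t ∈ Finset.Icc (1 : ℤ) N,
      (l * indIncr (U t ω) (w t ω) (w' t ω) (a t ω) (b t ω)
        - 2 * l ^ 2 * incrVar (w t ω) (w' t ω) (a t ω) (b t ω)))) := by
    refine ENNReal.measurable_ofReal.comp (Real.measurable_exp.comp
      (Finset.measurable_fun_sum _ fun t _ => ?_))
    have m1 := (hU t).mono (hle _) le_rfl
    have m2 := (hw t).mono (hle _) le_rfl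
    have m3 := (hw' t).mono (hle _) le_rfl
    have m4 := (ha t).mono (hle _) le_rfl
    have m5 := (hb t).mono (hle _) le_rfl
    exact ((m1.indIncr m2 m3 m4 m5).const_mul l).sub ((m2.incrVar m3 m4 m5).const_mul _)
  -- Markov's inequality: on the event in question the exponent is at least lx - 2l²v.
  have h2 := mul_meas_ge_le_lintegral (μ := P) hmeas
    (ENNReal.ofReal (Real.exp (l * x - 2 * l ^ 2 * v)))
  have hpos : 0 < Real.exp (l * x - 2 * l ^ 2 * v) := Real.exp_pos _
  have e : ENNReal.ofReal (Real.exp (-(l * x) + 2 * l ^ 2 * v))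
      = (ENNReal.ofReal (Real.exp (l * x - 2 * l ^ 2 * v)))⁻¹ := by
    rw [← ENNReal.ofReal_inv_of_pos hpos, ← Real.exp_neg]
    congr 2; ring
  rw [e, ENNReal.le_inv_iff_mul_le, mul_comm]
  refine le_trans ?_ (h2.trans h1)
  gcongr
  rintro ⟨hx, hv⟩
  refine ENNReal.ofReal_le_ofReal (Real.exp_le_exp.2 ?_)
  rw [Finset.sum_sub_distrib, ← Finset.mul_sum, ← Finset.mul_sum]
  nlinarith [mul_le_mul_of_nonneg_left hx.le hl, mul_le_mul_of_nonneg_left hv (sq_nonneg l)]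

/-- Exchanging the two weighted levels flips the sign of the increment and keeps its variation, so
the one-sided bound serves both tails. -/
lemma measure_lt_abs_sum_indIncr_le (hle : ∀ t, ℱ t ≤ m0) (hmono : ∀ t, ℱ t ≤ ℱ (t + 1))
    (hU : ∀ t, Measurable[ℱ (t + 1)] (U t)) {N : ℕ}
    (hunif : ∀ t ∈ Set.Icc (1 : ℤ) N, IsUniformGiven P (ℱ t) (U t))
    (hw : ∀ t, Measurable[ℱ t] (w t)) (hw' : ∀ t, Measurable[ℱ t] (w' t))
    (ha : ∀ t, Measurable[ℱ t] (a t)) (hb : ∀ t, Measurable[ℱ t] (b t))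
    (hwI : ∀ t ω, w t ω ∈ Set.Icc (0 : ℝ) 1) (hwI' : ∀ t ω, w' t ω ∈ Set.Icc (0 : ℝ) 1)
    (haI : ∀ t ω, a t ω ∈ Set.Icc (0 : ℝ) 1) (hbI : ∀ t ω, b t ω ∈ Set.Icc (0 : ℝ) 1)
    {l : ℝ} (hl : 0 ≤ l) (hl' : l ≤ 1 / 2) (x v : ℝ) :
    P {ω | x < |∑ t ∈ Finset.Icc (1 : ℤ) N, indIncr (U t ω) (w t ω) (w' t ω) (a t ω) (b t ω)|
        ∧ ∑ t ∈ Finset.Icc (1 : ℤ) N, incrVar (w t ω) (w' t ω) (a t ω) (b t ω) ≤ v}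
      ≤ 2 * ENNReal.ofReal (Real.exp (-(l * x) + 2 * l ^ 2 * v)) := by
  have h1 := measure_lt_sum_indIncr_le hle hmono hU hunif hw hw' ha hb hwI hwI' haI hbI hl hl' x v
  have h2 := measure_lt_sum_indIncr_le hle hmono hU hunif hw' hw hb ha hwI' hwI hbI haI hl hl' x v
  rw [two_mul]
  refine le_trans (le_trans (measure_mono ?_) (measure_union_le _ _)) (add_le_add h1 h2)
  rintro ω ⟨hx, hv⟩
  rcases lt_abs.1 hx with h | h
  · exact Or.inl ⟨h, hv⟩
  · refine Or.inr ⟨?_, ?_⟩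
    · rw [← Finset.sum_neg_distrib] at h
      simpa only [← indIncr_swap] using h
    · refine le_trans (le_of_eq (Finset.sum_congr rfl fun t _ => ?_)) hv
      exact incrVar_swap _ _ _ _

end Martingale

/-! ### The conditional probability integral transform -/

namespace SpecTest.IsStrictCDF

variable {F : ℝ → ℝ}

lemma pos (h : IsStrictCDF F) (y : ℝ) : 0 < F y :=
  (h.strictMono.monotone.le_of_tendsto h.atBot (y - 1)).trans_lt (h.strictMono (by linarith))

lemma lt_one (h : IsStrictCDF F) (y : ℝ) : F y < 1 :=
  (h.strictMono (by linarith : y < y + 1)).trans_le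
    (h.strictMono.monotone.ge_of_tendsto h.atTop (y + 1))

lemma exists_eq (h : IsStrictCDF F) {r : ℝ} (h0 : 0 < r) (h1 : r < 1) : ∃ q, F q = r :=
  mem_range_of_exists_le_of_exists_ge h.continuous
    ((h.atBot.eventually (gt_mem_nhds h0)).exists.imp fun _ => le_of_lt)
    ((h.atTop.eventually (lt_mem_nhds h1)).exists.imp fun _ => le_of_lt)

lemma convexComb {H : ℝ → ℝ} (hF : IsStrictCDF F) (hH : IsStrictCDF H) {c : ℝ} (h0 : 0 ≤ c)
    (h1 : c ≤ 1) : IsStrictCDF fun y => (1 - c) * F y + c * H y where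
  continuous := (hF.continuous.const_mul _).add (hH.continuous.const_mul _)
  strictMono := by
    intro x y hxy
    have h2 := hF.strictMono hxy
    have h3 := hH.strictMono hxy
    rcases h0.eq_or_lt with rfl | h0
    · simpa using h2
    · have := mul_le_mul_of_nonneg_left h2.le (sub_nonneg.2 h1)
      have := mul_lt_mul_of_pos_left h3 h0
      simp only
      linarith
  atBot := by simpa using (hF.atBot.const_mul (1 - c)).add (hH.atBot.const_mul c)
  atTop := by simpa using (hF.atTop.const_mul (1 - c)).add (hH.atTop.const_mul c)

/-- A probability measure whose distribution function agrees with `F` at the rationals. -/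
lemma measureReal_Iic_eq (hF : IsStrictCDF F) {ν : Measure ℝ} [IsProbabilityMeasure ν]
    (h : ∀ q : ℚ, ν.real (Set.Iic (q : ℝ)) = F q) (y : ℝ) : ν.real (Set.Iic y) = F y := by
  apply le_antisymm
  · by_contra! hlt
    obtain ⟨u, hu, hsub⟩ := exists_Ico_subset_of_mem_nhds
      (hF.continuous.continuousAt.eventually (gt_mem_nhds hlt)) (exists_gt y)
    obtain ⟨q, hq1, hq2⟩ := exists_rat_btwn hu
    have h1 : F q < ν.real (Set.Iic y) := hsub ⟨hq1.le, hq2⟩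
    rw [← h q] at h1
    exact absurd (measureReal_mono (μ := ν) (Set.Iic_subset_Iic.2 hq1.le)) (not_le.2 h1)
  · by_contra! hlt
    obtain ⟨u, hu, hsub⟩ := exists_Ioc_subset_of_mem_nhds
      (hF.continuous.continuousAt.eventually (lt_mem_nhds hlt)) (exists_lt y)
    obtain ⟨q, hq1, hq2⟩ := exists_rat_btwn hu
    have h1 : ν.real (Set.Iic y) < F q := hsub ⟨hq1, hq2.le⟩
    rw [← h q] at h1
    exact absurd (measureReal_mono (μ := ν) (Set.Iic_subset_Iic.2 hq2.le)) (not_le.2 h1)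

/-- The probability integral transform. -/
lemma measure_setOf_le (hF : IsStrictCDF F) {ν : Measure ℝ} [IsProbabilityMeasure ν]
    (h : ∀ y, ν.real (Set.Iic y) = F y) {s : ℝ} (hs : s ∈ Set.Icc (0 : ℝ) 1) :
    ν {y | F y ≤ s} = ENNReal.ofReal s := by
  rcases hs.1.eq_or_lt with rfl | h0
  · have : {y | F y ≤ 0} = ∅ := by
      ext y; simpa using hF.pos y
    rw [this]; simp
  rcases hs.2.eq_or_lt with rfl | h1
  · have : {y | F y ≤ 1} = Set.univ := by
      ext y; simpa using (hF.lt_one y).le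
    rw [this]; simp
  · obtain ⟨q, hq⟩ := hF.exists_eq h0 h1
    have : {y | F y ≤ s} = Set.Iic q := by
      ext y; rw [← hq]; exact hF.strictMono.le_iff_le
    rw [this, ← hq, ← h q, ofReal_measureReal]

end SpecTest.IsStrictCDF

/-- A Carathéodory function: continuous in `y`, measurable in `x`. -/
lemma measurable_uncurry_of_isStrictCDF {E : Type*} [MeasurableSpace E] {G : E → ℝ → ℝ}
    (hG : ∀ x, IsStrictCDF (G x)) (hGm : ∀ y, Measurable fun x => G x y) :
    Measurable fun p : E × ℝ => G p.1 p.2 :=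
  (measurable_uncurry_of_continuous_of_measurable (u := fun y x => G x y)
    (fun x => (hG x).continuous) hGm).comp measurable_swap

/-- The conditional probability integral transform. -/
lemma isUniformGiven_of_condCDF {Ω E : Type*} [MeasurableSpace Ω] [MeasurableSpace E]
    {P : Measure Ω} [IsProbabilityMeasure P] {X : Ω → E} {Y : Ω → ℝ} (hX : Measurable X)
    (hY : Measurable Y) {G : E → ℝ → ℝ} (hG : ∀ x, IsStrictCDF (G x))
    (hGm : ∀ y, Measurable fun x => G x y)
    (hdata : ∀ y : ℝ, P[Set.indicator {ω | Y ω ≤ y} (fun _ => (1 : ℝ)) |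
      MeasurableSpace.comap X inferInstance] =ᵐ[P] fun ω => G (X ω) y) :
    IsUniformGiven P (MeasurableSpace.comap X inferInstance) fun ω => G (X ω) (Y ω) := by
  -- The exceptional null set depends on `y`; restricting to rationals leaves one null set, and
  -- continuity of `G` recovers the remaining `y`.
  have hae : ∀ᵐ ω ∂P, ∀ q : ℚ,
      (ProbabilityTheory.condDistrib Y X P (X ω)).real (Set.Iic (q : ℝ)) = G (X ω) q := by
    rw [ae_all_iff]
    intro q
    exact (ProbabilityTheory.condDistrib_ae_eq_condExp hX hY measurableSet_Iic).trans (hdata q)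
  rintro _ ⟨B, hB, rfl⟩ s hs
  have hS : MeasurableSet {p : E × ℝ | p.1 ∈ B ∧ G p.1 p.2 ≤ s} :=
    (measurable_fst hB).inter
      (measurableSet_le (measurable_uncurry_of_isStrictCDF hG hGm) measurable_const)
  have h1 : P (X ⁻¹' B ∩ {ω | G (X ω) (Y ω) ≤ s})
      = P.map (fun ω => (X ω, Y ω)) {p : E × ℝ | p.1 ∈ B ∧ G p.1 p.2 ≤ s} := by
    rw [Measure.map_apply (hX.prodMk hY) hS]; rfl
  rw [h1, ← ProbabilityTheory.compProd_map_condDistrib hY.aemeasurable,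
    Measure.compProd_apply hS,
    lintegral_map (ProbabilityTheory.Kernel.measurable_kernel_prodMk_left hS) hX]
  calc _ = ∫⁻ ω, (X ⁻¹' B).indicator (fun _ => ENNReal.ofReal s) ω ∂P := by
        refine lintegral_congr_ae ?_
        filter_upwards [hae] with ω hω
        by_cases hB' : X ω ∈ B
        · rw [Set.indicator_of_mem (show ω ∈ X ⁻¹' B from hB'),
            ← (hG (X ω)).measure_setOf_le ((hG (X ω)).measureReal_Iic_eq hω) hs]
          congr 1
          ext y
          exact and_iff_right hB'
        · rw [Set.indicator_of_notMem (show ω ∉ X ⁻¹' B from hB')]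
          refine measure_mono_null (t := ∅) ?_ measure_empty
          exact fun y hy => absurd hy.1 hB'
    _ = _ := by
        rw [lintegral_indicator (hX hB), setLIntegral_const, mul_comm]

/-! ### The level map `η` -/

section Eta

variable {Θ : Type*} {F : ℤ → (ℕ → ℝ) → Θ → ℝ → ℝ} {H : ℤ → (ℕ → ℝ) → ℝ → ℝ}

lemma isStrictCDF_mixCDF (hF : ∀ t x θ, IsStrictCDF (F t x θ)) (hH : ∀ t x, IsStrictCDF (H t x))
    {δ : ℝ} {n : ℕ} (h0 : 0 ≤ δ) (h1 : δ ≤ √(n : ℝ)) (t : ℤ) (x : ℕ → ℝ) (θ : Θ) :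
    IsStrictCDF (mixCDF F H δ n t x θ) :=
  (hF t x θ).convexComb (hH t x) (div_nonneg h0 (Real.sqrt_nonneg _))
    (div_le_one_of_le₀ h1 (Real.sqrt_nonneg _))

lemma measurable_mixCDF [MeasurableSpace Θ]
    (hFm : ∀ t y, Measurable fun p : (ℕ → ℝ) × Θ => F t p.1 p.2 y)
    (hHm : ∀ t y, Measurable fun x : ℕ → ℝ => H t x y) (δ : ℝ) (n : ℕ) (t : ℤ) (θ : Θ) (y : ℝ) :
    Measurable fun x => mixCDF F H δ n t x θ y :=
  (((hFm t y).comp (measurable_id.prodMk measurable_const)).const_mul _).add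
    ((hHm t y).const_mul _)

lemma quantile_zero (G : ℝ → ℝ) : quantile G 0 = ⊥ := by
  refine le_bot_iff.1 (sInf_le ?_)
  show (0 : ℝ) ≤ extCDF G ⊥
  simp [extCDF]

lemma extCDF_coe (G : ℝ → ℝ) (y : ℝ) : extCDF G y = G y := by simp [extCDF]

lemma quantile_one {G : ℝ → ℝ} (hG : IsStrictCDF G) : quantile G 1 = ⊤ := by
  refine sInf_eq_top.2 fun y hy => ?_
  have hy' : (1 : ℝ) ≤ extCDF G y := hy
  induction y with
  | bot => simp [extCDF] at hy'; linarith
  | coe y => rw [extCDF_coe] at hy'; exact absurd (hG.lt_one y) (not_lt.2 hy')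
  | top => rfl

lemma quantile_apply {G : ℝ → ℝ} (hG : IsStrictCDF G) (q : ℝ) : quantile G (G q) = q := by
  refine le_antisymm (sInf_le ?_) (le_sInf fun y hy => ?_)
  · show G q ≤ extCDF G q
    rw [extCDF_coe]
  · have hy' : G q ≤ extCDF G y := hy
    induction y with
    | bot => simp [extCDF] at hy'; exact absurd (hG.pos q) (not_lt.2 hy')
    | coe y => rw [extCDF_coe] at hy'; exact EReal.coe_le_coe_iff.2 (hG.strictMono.le_iff_le.1 hy')
    | top => exact le_top

lemma extCDF_quantile_zero (F G : ℝ → ℝ) : extCDF G (quantile F 0) = 0 := by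
  rw [quantile_zero F]; simp [extCDF]

lemma extCDF_quantile_one {F G : ℝ → ℝ} (hF : IsStrictCDF F) : extCDF G (quantile F 1) = 1 := by
  rw [quantile_one hF]; simp [extCDF]

lemma extCDF_quantile_apply {F G : ℝ → ℝ} (hF : IsStrictCDF F) (q : ℝ) :
    extCDF G (quantile F (F q)) = G q := by
  rw [quantile_apply hF, extCDF_coe]

/-- Comparing a transform to a level is comparing the other transform to the mapped level. -/
lemma le_iff_le_extCDF_quantile {F G : ℝ → ℝ} (hF : IsStrictCDF F) (hG : IsStrictCDF G)
    {r : ℝ} (hr : r ∈ Set.Icc (0 : ℝ) 1) (y : ℝ) : F y ≤ r ↔ G y ≤ extCDF G (quantile F r) := by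
  rcases hr.1.eq_or_lt with rfl | h0
  · rw [extCDF_quantile_zero]
    exact iff_of_false (not_le.2 (hF.pos y)) (not_le.2 (hG.pos y))
  rcases hr.2.eq_or_lt with rfl | h1
  · rw [extCDF_quantile_one hF]
    exact iff_of_true (hF.lt_one y).le (hG.lt_one y).le
  · obtain ⟨q, rfl⟩ := hF.exists_eq h0 h1
    rw [extCDF_quantile_apply hF, hF.strictMono.le_iff_le, hG.strictMono.le_iff_le]

lemma extCDF_quantile_mem {F G : ℝ → ℝ} (hG : IsStrictCDF G) (r : ℝ) :
    extCDF G (quantile F r) ∈ Set.Icc (0 : ℝ) 1 := by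
  induction quantile F r with
  | bot => simp [extCDF]
  | coe y => rw [extCDF_coe]; exact ⟨(hG.pos y).le, (hG.lt_one y).le⟩
  | top => simp [extCDF]

lemma monotone_extCDF {G : ℝ → ℝ} (hG : IsStrictCDF G) : Monotone (extCDF G) := by
  intro x y hxy
  induction x with
  | bot =>
    have : extCDF G ⊥ = 0 := by simp [extCDF]
    rw [this]
    induction y with
    | bot => simp [extCDF]
    | coe y => rw [extCDF_coe]; exact (hG.pos y).le
    | top => simp [extCDF]
  | coe x =>
    induction y with
    | bot => simp at hxy
    | coe y =>
      rw [extCDF_coe, extCDF_coe]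
      exact hG.strictMono.monotone (EReal.coe_le_coe_iff.1 hxy)
    | top => rw [extCDF_coe]; simp [extCDF, (hG.lt_one x).le]
  | top => rw [top_le_iff.1 hxy]

lemma monotone_quantile (F : ℝ → ℝ) : Monotone (quantile F) := fun _ _ h =>
  sInf_le_sInf fun _ hy => le_trans h hy

/-- The map `(x, u) ↦ η(r, u)` is jointly measurable. -/
lemma measurable_eta [MeasurableSpace Θ] (hF : ∀ t x θ, IsStrictCDF (F t x θ))
    (hFm : ∀ t y, Measurable fun p : (ℕ → ℝ) × Θ => F t p.1 p.2 y)
    (hHm : ∀ t y, Measurable fun x : ℕ → ℝ => H t x y) {δ : ℝ} {n : ℕ} {θ : Θ} {t : ℤ}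
    (hG : ∀ x, IsStrictCDF (mixCDF F H δ n t x θ)) {r : ℝ} (hr : r ∈ Set.Icc (0 : ℝ) 1) :
    Measurable fun p : (ℕ → ℝ) × Θ => eta F H δ n θ t p.1 r p.2 := by
  unfold eta
  -- The end levels have infinite quantiles and are split off; at interior levels the quantile is a
  -- real root `q`, with `q ≤ y` exactly when `r ≤ F y`.
  rcases hr.1.eq_or_lt with rfl | h0
  · simp only [extCDF_quantile_zero]; exact measurable_const
  rcases hr.2.eq_or_lt with rfl | h1
  · simp only [extCDF_quantile_one (hF _ _ _)]; exact measurable_const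
  choose q hq using fun p : (ℕ → ℝ) × Θ => (hF t p.1 p.2).exists_eq h0 h1
  have hqm : Measurable q := by
    refine measurable_of_Iic fun y => ?_
    have : q ⁻¹' Set.Iic y = {p | r ≤ F t p.1 p.2 y} := by
      ext p
      show q p ≤ y ↔ r ≤ F t p.1 p.2 y
      conv_rhs => rw [← hq p]
      exact (hF t p.1 p.2).strictMono.le_iff_le.symm
    rw [this]
    exact measurableSet_le measurable_const (hFm t y)
  have : (fun p : (ℕ → ℝ) × Θ => extCDF (mixCDF F H δ n t p.1 θ) (quantile (F t p.1 p.2) r))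
      = fun p => mixCDF F H δ n t p.1 θ (q p) := by
    ext p
    conv_lhs => rw [← hq p]
    exact extCDF_quantile_apply (hF _ _ _) _
  rw [this]
  exact (measurable_uncurry_of_isStrictCDF hG (measurable_mixCDF hFm hHm δ n t θ)).comp
    (measurable_fst.prodMk hqm)

end Eta

/-! ### Brackets and the deterministic comparison -/

/-- The weight `I(U_{t-1} ≤ c_{t-1})`, set to zero at the first time point. -/
noncomputable def lagWeight (U c : ℤ → ℝ) (t : ℤ) : ℝ :=
  if t ≤ 1 then 0 else ind (U (t - 1)) (c (t - 1))

lemma lagWeight_mem (U c : ℤ → ℝ) (t : ℤ) : lagWeight U c t ∈ Set.Icc (0 : ℝ) 1 := by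
  unfold lagWeight
  split_ifs
  · exact ⟨le_rfl, zero_le_one⟩
  · exact ⟨ind_nonneg _ _, ind_le_one _ _⟩

/-- `lo` and `hi` bracket the levels `x` up to total width `e`, within the class `𝒜`. -/
structure IsBracket (𝒜 : Set (ℤ → ℝ)) (n : ℕ) (e : ℝ) (x lo hi : ℤ → ℝ) : Prop where
  lo_mem : lo ∈ 𝒜
  hi_mem : hi ∈ 𝒜
  nonneg : ∀ t ∈ Finset.Icc (1 : ℤ) n, 0 ≤ lo t
  lo_le : ∀ t ∈ Finset.Icc (1 : ℤ) n, lo t ≤ x t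
  le_hi : ∀ t ∈ Finset.Icc (1 : ℤ) n, x t ≤ hi t
  le_one : ∀ t ∈ Finset.Icc (1 : ℤ) n, hi t ≤ 1
  width : ∑ t ∈ Finset.Icc (1 : ℤ) n, (hi t - lo t) ≤ e

/-- The sums of weighted centred indicators with levels in `𝒜` are small on the scale `e`
whenever their variation is at most `v`. -/
structure SmallSums (𝒜 : Set (ℤ → ℝ)) (n : ℕ) (U : ℤ → ℝ) (e v : ℝ) : Prop where
  plain : ∀ a ∈ 𝒜, ∀ b ∈ 𝒜,
    ∑ t ∈ Finset.Icc (1 : ℤ) n, incrVar 1 1 (max (a t) (b t)) (min (a t) (b t)) ≤ v →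
    |∑ t ∈ Finset.Icc (1 : ℤ) n, indIncr (U t) 1 1 (max (a t) (b t)) (min (a t) (b t))| ≤ e
  lagged : ∀ a ∈ 𝒜, ∀ b ∈ 𝒜, ∀ c ∈ 𝒜, ∀ d ∈ 𝒜,
    ∑ t ∈ Finset.Icc (1 : ℤ) n, incrVar (lagWeight U c t) (lagWeight U d t) (a t) (b t) ≤ v →
    |∑ t ∈ Finset.Icc (1 : ℤ) n,
      indIncr (U t) (lagWeight U c t) (lagWeight U d t) (a t) (b t)| ≤ e

lemma incrVar_one_max_min (a b : ℝ) : incrVar 1 1 (max a b) (min a b) = |a - b| := by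
  unfold incrVar
  rw [sub_self, abs_zero, zero_add, max_sub_min_eq_abs', abs_abs]

lemma sum_Icc_two_pred (n : ℕ) (g : ℤ → ℝ) :
    ∑ t ∈ Finset.Icc (2 : ℤ) n, g (t - 1) = ∑ t ∈ Finset.Icc (1 : ℤ) (n - 1), g t := by
  refine Finset.sum_bij' (fun t _ => t - 1) (fun t _ => t + 1) ?_ ?_ ?_ ?_ ?_ <;>
    simp only [Finset.mem_Icc] <;> intros <;> first | omega | simp

lemma sum_Icc_two_pred_le (n : ℕ) {g : ℤ → ℝ} (hg : ∀ t ∈ Finset.Icc (1 : ℤ) n, 0 ≤ g t) :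
    ∑ t ∈ Finset.Icc (2 : ℤ) n, g (t - 1) ≤ ∑ t ∈ Finset.Icc (1 : ℤ) n, g t := by
  rw [sum_Icc_two_pred]
  exact Finset.sum_le_sum_of_subset_of_nonneg (Finset.Icc_subset_Icc_right (by omega))
    fun t ht _ => hg t ht

lemma sum_Icc_two_le (n : ℕ) {g : ℤ → ℝ} (hg : ∀ t ∈ Finset.Icc (1 : ℤ) n, 0 ≤ g t) :
    ∑ t ∈ Finset.Icc (2 : ℤ) n, g t ≤ ∑ t ∈ Finset.Icc (1 : ℤ) n, g t :=
  Finset.sum_le_sum_of_subset_of_nonneg (Finset.Icc_subset_Icc_left (by omega))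
    fun t ht _ => hg t ht

lemma sum_Icc_one_eq (n : ℕ) {g : ℤ → ℝ} (hg : g 1 = 0) :
    ∑ t ∈ Finset.Icc (1 : ℤ) n, g t = ∑ t ∈ Finset.Icc (2 : ℤ) n, g t := by
  refine (Finset.sum_subset (Finset.Icc_subset_Icc_left (by omega)) fun t ht ht' => ?_).symm
  rw [Finset.mem_Icc] at ht ht'
  rw [show t = 1 by omega, hg]

section Deterministic

variable {𝒜 : Set (ℤ → ℝ)} {n : ℕ} {U : ℤ → ℝ} {e e' v v' : ℝ}

/-- The number of observations between two levels. -/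
lemma SmallSums.sum_abs_ind_sub_le (h : SmallSums 𝒜 n U e v) {a b : ℤ → ℝ} (ha : a ∈ 𝒜)
    (hb : b ∈ 𝒜) (hab : ∑ t ∈ Finset.Icc (1 : ℤ) n, |a t - b t| ≤ v) :
    ∑ t ∈ Finset.Icc (1 : ℤ) n, |ind (U t) (a t) - ind (U t) (b t)|
      ≤ ∑ t ∈ Finset.Icc (1 : ℤ) n, |a t - b t| + e := by
  have h1 := h.plain a ha b hb (by simpa only [incrVar_one_max_min] using hab)
  -- The count equals its compensator plus a centred sum of the `plain` kind, once the levels are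
  -- ordered by max and min.
  have h2 : ∑ t ∈ Finset.Icc (1 : ℤ) n, |ind (U t) (a t) - ind (U t) (b t)|
      = ∑ t ∈ Finset.Icc (1 : ℤ) n, |a t - b t|
        + ∑ t ∈ Finset.Icc (1 : ℤ) n, indIncr (U t) 1 1 (max (a t) (b t)) (min (a t) (b t)) := by
    rw [← Finset.sum_add_distrib]
    refine Finset.sum_congr rfl fun t _ => ?_
    rw [abs_ind_sub_ind, ← max_sub_min_eq_abs' (a t) (b t), indIncr]
    ring
  rw [h2]
  linarith [(abs_le.1 h1).2]

/-- The variation of the random weights is the number of lagged observations between `c` and `d`, at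
most v' + e by the plain sums; the levels `a`, `b` add v', whence 2v' + e. -/
lemma SmallSums.abs_sum_lagged_le (h : SmallSums 𝒜 n U e v) (hv : 2 * v' + e ≤ v) (hv' : v' ≤ v)
    {a b c d : ℤ → ℝ} (ha : a ∈ 𝒜) (hb : b ∈ 𝒜) (hc : c ∈ 𝒜) (hd : d ∈ 𝒜)
    (hab : ∑ t ∈ Finset.Icc (1 : ℤ) n, |a t - b t| ≤ v')
    (hcd : ∑ t ∈ Finset.Icc (1 : ℤ) n, |c t - d t| ≤ v') :
    |∑ t ∈ Finset.Icc (2 : ℤ) n, indIncr (U t) (ind (U (t - 1)) (c (t - 1)))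
      (ind (U (t - 1)) (d (t - 1))) (a t) (b t)| ≤ e := by
  have h1 := h.sum_abs_ind_sub_le hc hd (hcd.trans hv')
  have hw : ∑ t ∈ Finset.Icc (1 : ℤ) n, |lagWeight U c t - lagWeight U d t|
      ≤ ∑ t ∈ Finset.Icc (1 : ℤ) n, |ind (U t) (c t) - ind (U t) (d t)| := by
    rw [sum_Icc_one_eq n (by simp [lagWeight])]
    refine le_trans (Finset.sum_le_sum fun t ht => ?_) (sum_Icc_two_pred_le n
      (g := fun t => |ind (U t) (c t) - ind (U t) (d t)|) fun t _ => abs_nonneg _)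
    rw [Finset.mem_Icc] at ht
    simp [lagWeight, show ¬ t ≤ 1 by omega]
  have h2 := h.lagged a ha b hb c hc d hd (by
    simp only [incrVar, Finset.sum_add_distrib]
    linarith)
  rw [sum_Icc_one_eq n (by simp [lagWeight, indIncr])] at h2
  refine le_trans (le_of_eq ?_) h2
  congr 1
  refine Finset.sum_congr rfl fun t ht => ?_
  rw [Finset.mem_Icc] at ht
  simp [lagWeight, show ¬ t ≤ 1 by omega]

lemma IsBracket.lo_le_hi {x lo hi : ℤ → ℝ} (h : IsBracket 𝒜 n e x lo hi) :
    ∀ t ∈ Finset.Icc (1 : ℤ) n, lo t ≤ hi t := fun t ht => (h.lo_le t ht).trans (h.le_hi t ht)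

lemma IsBracket.sum_abs_sub_le {x x' lo hi lo' hi' : ℤ → ℝ} (h : IsBracket 𝒜 n e x lo hi)
    (h' : IsBracket 𝒜 n e x' lo' hi') {y y' : ℤ → ℝ}
    (hy : ∀ t ∈ Finset.Icc (1 : ℤ) n, y t ∈ Set.Icc (lo t) (hi t))
    (hy' : ∀ t ∈ Finset.Icc (1 : ℤ) n, y' t ∈ Set.Icc (lo' t) (hi' t)) :
    ∑ t ∈ Finset.Icc (1 : ℤ) n, |y t - y' t|
      ≤ ∑ t ∈ Finset.Icc (1 : ℤ) n, |x t - x' t| + 2 * e := by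
  have : ∑ t ∈ Finset.Icc (1 : ℤ) n, |y t - y' t|
      ≤ ∑ t ∈ Finset.Icc (1 : ℤ) n, (|x t - x' t| + (hi t - lo t) + (hi' t - lo' t)) := by
    refine Finset.sum_le_sum fun t ht => ?_
    have a1 := hy t ht
    have a2 := hy' t ht
    have a3 := h.lo_le t ht
    have a4 := h.le_hi t ht
    have a5 := h'.lo_le t ht
    have a6 := h'.le_hi t ht
    have a7 := neg_abs_le (x t - x' t)
    have a8 := le_abs_self (x t - x' t)
    rw [abs_le]
    constructor <;> linarith [a1.1, a1.2, a2.1, a2.2]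
  rw [Finset.sum_add_distrib, Finset.sum_add_distrib] at this
  linarith [h.width, h'.width]

/-- The expression is not monotone in `x`, but it is a difference of two products, each monotone in
both levels. Bounding these at opposite bracket ends costs the count between the ends plus the
width. -/
lemma ind_mul_ind_sub_le {u u' x y xl xh yl yh : ℝ} (hxl : xl ≤ x) (hxh : x ≤ xh) (hyl : yl ≤ y)
    (hyh : y ≤ yh) (h0 : 0 ≤ xl) (h1 : xh ≤ 1) :
    ind u y * (ind u' x - x)
      ≤ ind u yh * (ind u' xh - xh) + (ind u yh - ind u yl) + (xh - xl) := by
  have a1 := ind_mono u hyl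
  have a2 := ind_mono u hyh
  have a3 := ind_mono u' hxh
  have b0 := ind_nonneg u y
  have b1 := ind_le_one u y
  have b2 := ind_nonneg u yl
  have b3 := ind_nonneg u' xh
  have b4 := ind_le_one u' xh
  have b5 := ind_le_one u yh
  have c1 : ind u y * ind u' x ≤ ind u yh * ind u' xh :=
    mul_le_mul a2 a3 (ind_nonneg _ _) (ind_nonneg _ _)
  have c2 : ind u yl * xl ≤ ind u y * x := mul_le_mul a1 hxl h0 b0
  have c3 : (ind u yh - ind u yl) * xl ≤ ind u yh - ind u yl :=
    mul_le_of_le_one_right (by linarith) (by linarith)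
  have c4 : ind u yh * (xh - xl) ≤ xh - xl :=
    mul_le_of_le_one_left (by linarith) b5
  nlinarith

lemma le_ind_mul_ind_sub {u u' x y xl xh yl yh : ℝ} (hxl : xl ≤ x) (hxh : x ≤ xh) (hyl : yl ≤ y)
    (hyh : y ≤ yh) (h0 : 0 ≤ xl) (h1 : xh ≤ 1) :
    ind u yl * (ind u' xl - xl) - (ind u yh - ind u yl) - (xh - xl)
      ≤ ind u y * (ind u' x - x) := by
  have a1 := ind_mono u hyl
  have a2 := ind_mono u hyh
  have a3 := ind_mono u' hxl
  have b0 := ind_nonneg u y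
  have b5 := ind_le_one u yl
  have c1 : ind u yl * ind u' xl ≤ ind u y * ind u' x :=
    mul_le_mul a1 a3 (ind_nonneg _ _) (ind_nonneg _ _)
  have c2 : ind u y * x ≤ ind u yh * xh := mul_le_mul a2 hxh (h0.trans hxl) (ind_nonneg _ _)
  have c3 : (ind u yh - ind u yl) * xh ≤ ind u yh - ind u yl :=
    mul_le_of_le_one_right (by linarith) h1
  have c4 : ind u yl * (xh - xl) ≤ xh - xl :=
    mul_le_of_le_one_left (by linarith) b5
  nlinarith

/-- Comparison of the lagged sums at two bracketed pairs of levels. -/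
lemma SmallSums.abs_sum_sub_le (h : SmallSums 𝒜 n U e v) (hv : 2 * v' + e ≤ v) (hv' : v' ≤ v)
    {w : ℝ} (hw0 : 0 ≤ w) (hw : w + 2 * e' ≤ v') (he' : 0 ≤ e')
    {x y x' y' xl xh yl yh xl' xh' yl' yh' : ℤ → ℝ}
    (hx : IsBracket 𝒜 n e' x xl xh) (hy : IsBracket 𝒜 n e' y yl yh)
    (hx' : IsBracket 𝒜 n e' x' xl' xh') (hy' : IsBracket 𝒜 n e' y' yl' yh')
    (hxx : ∑ t ∈ Finset.Icc (1 : ℤ) n, |x t - x' t| ≤ w)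
    (hyy : ∑ t ∈ Finset.Icc (1 : ℤ) n, |y t - y' t| ≤ w) :
    |∑ t ∈ Finset.Icc (2 : ℤ) n,
      (ind (U (t - 1)) (y (t - 1)) * (ind (U t) (x t) - x t)
        - ind (U (t - 1)) (y' (t - 1)) * (ind (U t) (x' t) - x' t))| ≤ 3 * e + 4 * e' := by
  have count : ∀ {z zl zh : ℤ → ℝ}, IsBracket 𝒜 n e' z zl zh →
      ∑ t ∈ Finset.Icc (2 : ℤ) n, (ind (U (t - 1)) (zh (t - 1)) - ind (U (t - 1)) (zl (t - 1)))
        ≤ e' + e := by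
    intro z zl zh hz
    refine le_trans (sum_Icc_two_pred_le n (g := fun t => ind (U t) (zh t) - ind (U t) (zl t))
      fun t ht => sub_nonneg.2 (ind_mono _ (hz.lo_le_hi t ht))) ?_
    have e1 : ∑ t ∈ Finset.Icc (1 : ℤ) n, |zh t - zl t| ≤ e' := by
      refine le_trans (le_of_eq (Finset.sum_congr rfl fun t ht => ?_)) hz.width
      exact abs_of_nonneg (sub_nonneg.2 (hz.lo_le_hi t ht))
    have e2 := h.sum_abs_ind_sub_le hz.hi_mem hz.lo_mem (by linarith)
    have e3 : ∑ t ∈ Finset.Icc (1 : ℤ) n, (ind (U t) (zh t) - ind (U t) (zl t))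
        ≤ ∑ t ∈ Finset.Icc (1 : ℤ) n, |ind (U t) (zh t) - ind (U t) (zl t)| :=
      Finset.sum_le_sum fun t _ => le_abs_self _
    linarith
  have width : ∀ {z zl zh : ℤ → ℝ}, IsBracket 𝒜 n e' z zl zh →
      ∑ t ∈ Finset.Icc (2 : ℤ) n, (zh t - zl t) ≤ e' := fun hz =>
    le_trans (sum_Icc_two_le n fun t ht => sub_nonneg.2 (hz.lo_le_hi t ht)) hz.width
  have mlo : ∀ {z zl zh : ℤ → ℝ}, IsBracket 𝒜 n e' z zl zh →
      ∀ t ∈ Finset.Icc (1 : ℤ) n, zl t ∈ Set.Icc (zl t) (zh t) :=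
    fun hz t ht => ⟨le_rfl, hz.lo_le_hi t ht⟩
  have mhi : ∀ {z zl zh : ℤ → ℝ}, IsBracket 𝒜 n e' z zl zh →
      ∀ t ∈ Finset.Icc (1 : ℤ) n, zh t ∈ Set.Icc (zl t) (zh t) :=
    fun hz t ht => ⟨hz.lo_le_hi t ht, le_rfl⟩
  -- Opposite ends of the two brackets are paired. The lagged sum costs e, each of two counts e +
  -- e', each of two widths e': in total 3e + 4e'.
  have up := h.abs_sum_lagged_le hv hv' hx.hi_mem hx'.lo_mem hy.hi_mem hy'.lo_mem
    ((hx.sum_abs_sub_le hx' (mhi hx) (mlo hx')).trans (by linarith))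
    ((hy.sum_abs_sub_le hy' (mhi hy) (mlo hy')).trans (by linarith))
  have dn := h.abs_sum_lagged_le hv hv' hx.lo_mem hx'.hi_mem hy.lo_mem hy'.hi_mem
    ((hx.sum_abs_sub_le hx' (mlo hx) (mhi hx')).trans (by linarith))
    ((hy.sum_abs_sub_le hy' (mlo hy) (mhi hy')).trans (by linarith))
  have c1 := count hy
  have c2 := count hy'
  have w1 := width hx
  have w2 := width hx'
  have mem1 : ∀ t ∈ Finset.Icc (2 : ℤ) n, t ∈ Finset.Icc (1 : ℤ) n ∧ t - 1 ∈ Finset.Icc (1 : ℤ) n := by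
    intro t ht
    simp only [Finset.mem_Icc] at ht ⊢
    omega
  rw [abs_le]
  constructor
  · have := Finset.sum_le_sum (s := Finset.Icc (2 : ℤ) n) (f := fun t =>
      indIncr (U t) (ind (U (t - 1)) (yl (t - 1))) (ind (U (t - 1)) (yh' (t - 1))) (xl t) (xh' t)
      - (ind (U (t - 1)) (yh (t - 1)) - ind (U (t - 1)) (yl (t - 1))) - (xh t - xl t)
      - (ind (U (t - 1)) (yh' (t - 1)) - ind (U (t - 1)) (yl' (t - 1))) - (xh' t - xl' t))
      (g := fun t => ind (U (t - 1)) (y (t - 1)) * (ind (U t) (x t) - x t)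
        - ind (U (t - 1)) (y' (t - 1)) * (ind (U t) (x' t) - x' t)) (fun t ht => by
        obtain ⟨m1, m2⟩ := mem1 t ht
        have i1 := le_ind_mul_ind_sub (u := U (t - 1)) (u' := U t) (hx.lo_le t m1) (hx.le_hi t m1)
          (hy.lo_le _ m2) (hy.le_hi _ m2) (hx.nonneg t m1) (hx.le_one t m1)
        have i2 := ind_mul_ind_sub_le (u := U (t - 1)) (u' := U t) (hx'.lo_le t m1)
          (hx'.le_hi t m1) (hy'.lo_le _ m2) (hy'.le_hi _ m2) (hx'.nonneg t m1) (hx'.le_one t m1)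
        simp only [indIncr]
        linarith)
    simp only [Finset.sum_sub_distrib] at this c1 c2 w1 w2 ⊢
    linarith [(abs_le.1 dn).1]
  · have := Finset.sum_le_sum (s := Finset.Icc (2 : ℤ) n) (g := fun t =>
      indIncr (U t) (ind (U (t - 1)) (yh (t - 1))) (ind (U (t - 1)) (yl' (t - 1))) (xh t) (xl' t)
      + (ind (U (t - 1)) (yh (t - 1)) - ind (U (t - 1)) (yl (t - 1))) + (xh t - xl t)
      + (ind (U (t - 1)) (yh' (t - 1)) - ind (U (t - 1)) (yl' (t - 1))) + (xh' t - xl' t))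
      (f := fun t => ind (U (t - 1)) (y (t - 1)) * (ind (U t) (x t) - x t)
        - ind (U (t - 1)) (y' (t - 1)) * (ind (U t) (x' t) - x' t)) (fun t ht => by
        obtain ⟨m1, m2⟩ := mem1 t ht
        have i1 := ind_mul_ind_sub_le (u := U (t - 1)) (u' := U t) (hx.lo_le t m1) (hx.le_hi t m1)
          (hy.lo_le _ m2) (hy.le_hi _ m2) (hx.nonneg t m1) (hx.le_one t m1)
        have i2 := le_ind_mul_ind_sub (u := U (t - 1)) (u' := U t) (hx'.lo_le t m1)
          (hx'.le_hi t m1) (hy'.lo_le _ m2) (hy'.le_hi _ m2) (hx'.nonneg t m1) (hx'.le_one t m1)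
        simp only [indIncr]
        linarith)
    simp only [Finset.sum_add_distrib, Finset.sum_sub_distrib] at this c1 c2 w1 w2 ⊢
    linarith [(abs_le.1 up).2]

/-- The empirical processes are normalised by √(n - 1) and the drift by √n; this bounds the effect
of the mismatch on n - 1 terms. -/
lemma one_div_sqrt_sub_one_div_sqrt_le (hn : 2 ≤ n) :
    0 ≤ 1 / √((n : ℝ) - 1) - 1 / √(n : ℝ) ∧
      (1 / √((n : ℝ) - 1) - 1 / √(n : ℝ)) * (n - 1) ≤ 1 := by
  have hn' : (2 : ℝ) ≤ n := by exact_mod_cast hn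
  set p := √((n : ℝ) - 1) with hp
  set q := √(n : ℝ) with hq
  have hp0 : 0 < p := Real.sqrt_pos.2 (by linarith)
  have hpq : p ≤ q := Real.sqrt_le_sqrt (by linarith)
  have hq0 : 0 < q := hp0.trans_le hpq
  have hp2 : p ^ 2 = n - 1 := Real.sq_sqrt (by linarith)
  have hq2 : q ^ 2 = n := Real.sq_sqrt (by linarith)
  refine ⟨sub_nonneg.2 (one_div_le_one_div_of_le hp0 hpq), ?_⟩
  rw [← hp2]
  have h1 : (1 / p - 1 / q) * p ^ 2 = p * (q - p) / q := by field_simp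
  rw [h1, div_le_one hq0]
  nlinarith

/-- The uniform expansion of the empirical process, on the event that all sums over the bracketing
class are small. -/
lemma SmallSums.abs_empProc_sub_le (h : SmallSums 𝒜 n U e v) (hn : 2 ≤ n)
    (hv : 2 * v' + e ≤ v) (hv' : v' ≤ v) {k : ℝ} (hk : 0 ≤ k) (hw : n * k + 2 * e' ≤ v')
    (he' : 0 ≤ e') {Uhat : ℤ → ℝ} {η : ℤ → ℝ → ℝ}
    (hUhat : ∀ t ∈ Finset.Icc (1 : ℤ) n, ∀ r ∈ Set.Icc (0 : ℝ) 1,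
      ind (Uhat t) r = ind (U t) (η t r))
    (hU : ∀ t, U t ≤ 1) (hη1 : ∀ t, η t 1 = 1)
    (hηI : ∀ t r, η t r ∈ Set.Icc (0 : ℝ) 1)
    (hη : ∀ t ∈ Finset.Icc (1 : ℤ) n, ∀ r ∈ Set.Icc (0 : ℝ) 1, |η t r - r| ≤ k)
    (hbr : ∀ r ∈ Set.Icc (0 : ℝ) 1, ∃ lo hi, IsBracket 𝒜 n e' (fun t => η t r) lo hi)
    (hbr' : ∀ r ∈ Set.Icc (0 : ℝ) 1, ∃ lo hi, IsBracket 𝒜 n e' (fun _ => r) lo hi)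
    {r₁ r₂ : ℝ} (hr₁ : r₁ ∈ Set.Icc (0 : ℝ) 1) (hr₂ : r₂ ∈ Set.Icc (0 : ℝ) 1) :
    |empProc n Uhat r₁ r₂ - empProc n U r₁ r₂ - drift n U η r₁ r₂|
      ≤ 1 / √((n : ℝ) - 1) * (2 * (3 * e + 4 * e') + 4) + 2 * k := by
  have hn' : (2 : ℝ) ≤ n := by exact_mod_cast hn
  have hsum : ∀ r ∈ Set.Icc (0 : ℝ) 1, ∑ t ∈ Finset.Icc (1 : ℤ) n, |η t r - r| ≤ n * k := by
    intro r hr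
    refine (Finset.sum_le_card_nsmul _ _ k fun t ht => hη t ht r hr).trans (le_of_eq ?_)
    simp
  have hnk : 0 ≤ n * k := by positivity
  have one_mem : (1 : ℝ) ∈ Set.Icc (0 : ℝ) 1 := ⟨zero_le_one, le_rfl⟩
  have main : ∀ r ∈ Set.Icc (0 : ℝ) 1, ∀ s ∈ Set.Icc (0 : ℝ) 1,
      |∑ t ∈ Finset.Icc (2 : ℤ) n,
        (ind (U (t - 1)) (η (t - 1) s) * (ind (U t) (η t r) - η t r)
          - ind (U (t - 1)) s * (ind (U t) r - r))| ≤ 3 * e + 4 * e' := by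
    intro r hr s hs
    obtain ⟨_, _, b1⟩ := hbr r hr
    obtain ⟨_, _, b2⟩ := hbr s hs
    obtain ⟨_, _, b3⟩ := hbr' r hr
    obtain ⟨_, _, b4⟩ := hbr' s hs
    exact h.abs_sum_sub_le hv hv' hnk hw he' b1 b2 b3 b4 (hsum r hr) (hsum s hs)
  let g : ℤ → ℝ := fun t => (ind (U t) (η t r₂) - η t r₂) - (ind (U t) r₂ - r₂)
  have hg2 : ∀ t, |g t| ≤ 2 := by
    intro t
    have := ind_nonneg (U t) (η t r₂)
    have := ind_le_one (U t) (η t r₂)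
    have := ind_nonneg (U t) r₂
    have := ind_le_one (U t) r₂
    have := hηI t r₂
    simp only [g]
    rw [abs_le]
    constructor <;> linarith [this.1, this.2, hr₂.1, hr₂.2]
  -- With second level 1 all lagged weights equal 1, so `main` also controls the unlagged sum.
  -- Shifting time by one exchanges two end terms, each at most 2.
  have hshift : |∑ t ∈ Finset.Icc (2 : ℤ) n, g (t - 1)| ≤ 3 * e + 4 * e' + 4 := by
    have hm := main r₂ hr₂ 1 one_mem
    have e1 : ∑ t ∈ Finset.Icc (2 : ℤ) n,
        (ind (U (t - 1)) (η (t - 1) 1) * (ind (U t) (η t r₂) - η t r₂)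
          - ind (U (t - 1)) 1 * (ind (U t) r₂ - r₂)) = ∑ t ∈ Finset.Icc (2 : ℤ) n, g t := by
      refine Finset.sum_congr rfl fun t _ => ?_
      rw [hη1, show ind (U (t - 1)) 1 = 1 from if_pos (hU _), one_mul, one_mul]
    rw [e1] at hm
    have e2 : ∑ t ∈ Finset.Icc (2 : ℤ) n, g (t - 1) + g n
        = g 1 + ∑ t ∈ Finset.Icc (2 : ℤ) n, g t := by
      rw [sum_Icc_two_pred]
      have i1 : Finset.Icc (1 : ℤ) n = insert (n : ℤ) (Finset.Icc (1 : ℤ) (n - 1)) := by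
        ext t; simp only [Finset.mem_Icc, Finset.mem_insert]; omega
      have i2 : Finset.Icc (1 : ℤ) n = insert 1 (Finset.Icc (2 : ℤ) n) := by
        ext t; simp only [Finset.mem_Icc, Finset.mem_insert]; omega
      have j1 : ∑ t ∈ Finset.Icc (1 : ℤ) n, g t
          = g n + ∑ t ∈ Finset.Icc (1 : ℤ) (n - 1), g t := by
        rw [i1, Finset.sum_insert (by simp)]
      have j2 : ∑ t ∈ Finset.Icc (1 : ℤ) n, g t = g 1 + ∑ t ∈ Finset.Icc (2 : ℤ) n, g t := by
        rw [i2, Finset.sum_insert (by simp)]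
      linarith
    have := abs_le.1 (hg2 1)
    have := abs_le.1 (hg2 n)
    have := abs_le.1 hm
    rw [abs_le]
    constructor <;> linarith
  let dr : ℤ → ℝ := fun t => ind (U (t - 1)) (η (t - 1) r₂) * (η t r₁ - r₁)
    + r₁ * (η (t - 1) r₂ - r₂)
  have hdr : |∑ t ∈ Finset.Icc (2 : ℤ) n, dr t| ≤ (n - 1) * (2 * k) := by
    refine (Finset.abs_sum_le_sum_abs _ _).trans ?_
    refine (Finset.sum_le_card_nsmul _ _ (2 * k) fun t ht => ?_).trans (le_of_eq ?_)
    · have m1 : t ∈ Finset.Icc (1 : ℤ) n ∧ t - 1 ∈ Finset.Icc (1 : ℤ) n := by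
        simp only [Finset.mem_Icc] at ht ⊢
        omega
      refine (abs_add_le _ _).trans ?_
      rw [abs_mul, abs_mul, abs_of_nonneg (ind_nonneg _ _), abs_of_nonneg hr₁.1]
      have i1 := mul_le_of_le_one_left (abs_nonneg (η t r₁ - r₁))
        (ind_le_one (U (t - 1)) (η (t - 1) r₂))
      have i2 := mul_le_of_le_one_left (abs_nonneg (η (t - 1) r₂ - r₂)) hr₁.2
      linarith [hη t m1.1 r₁ hr₁, hη _ m1.2 r₂ hr₂]
    · have : ((n : ℤ) + 1 - 2).toNat = n - 1 := by omega
      rw [Int.card_Icc, this, nsmul_eq_mul, Nat.cast_sub (by omega), Nat.cast_one]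
  -- Each difference of products is a difference of products with centred leading factor, plus r₁
  -- times the centred difference at t - 1, plus the drift summand.
  have hdecomp : empProc n Uhat r₁ r₂ - empProc n U r₁ r₂ - drift n U η r₁ r₂
      = 1 / √((n : ℝ) - 1) * (∑ t ∈ Finset.Icc (2 : ℤ) n,
          (ind (U (t - 1)) (η (t - 1) r₂) * (ind (U t) (η t r₁) - η t r₁)
            - ind (U (t - 1)) r₂ * (ind (U t) r₁ - r₁))
          + r₁ * ∑ t ∈ Finset.Icc (2 : ℤ) n, g (t - 1))
        + (1 / √((n : ℝ) - 1) - 1 / √(n : ℝ)) * ∑ t ∈ Finset.Icc (2 : ℤ) n, dr t := by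
    have e1 : ∑ t ∈ Finset.Icc (2 : ℤ) n, (ind (Uhat t) r₁ * ind (Uhat (t - 1)) r₂ - r₁ * r₂)
        - ∑ t ∈ Finset.Icc (2 : ℤ) n, (ind (U t) r₁ * ind (U (t - 1)) r₂ - r₁ * r₂)
        = ∑ t ∈ Finset.Icc (2 : ℤ) n,
          (ind (U (t - 1)) (η (t - 1) r₂) * (ind (U t) (η t r₁) - η t r₁)
            - ind (U (t - 1)) r₂ * (ind (U t) r₁ - r₁))
          + r₁ * ∑ t ∈ Finset.Icc (2 : ℤ) n, g (t - 1) + ∑ t ∈ Finset.Icc (2 : ℤ) n, dr t := by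
      rw [Finset.mul_sum, ← Finset.sum_sub_distrib, ← Finset.sum_add_distrib,
        ← Finset.sum_add_distrib]
      refine Finset.sum_congr rfl fun t ht => ?_
      have m1 : t ∈ Finset.Icc (1 : ℤ) n ∧ t - 1 ∈ Finset.Icc (1 : ℤ) n := by
        simp only [Finset.mem_Icc] at ht ⊢
        omega
      rw [hUhat t m1.1 r₁ hr₁, hUhat _ m1.2 r₂ hr₂]
      simp only [g, dr]
      ring
    unfold empProc drift
    rw [← mul_sub, e1]
    simp only [dr]
    ring
  rw [hdecomp]
  obtain ⟨q0, q1⟩ := one_div_sqrt_sub_one_div_sqrt_le hn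
  have hs0 : 0 ≤ 1 / √((n : ℝ) - 1) := by positivity
  refine (abs_add_le _ _).trans (add_le_add ?_ ?_)
  · rw [abs_mul, abs_of_nonneg hs0]
    refine mul_le_mul_of_nonneg_left ((abs_add_le _ _).trans ?_) hs0
    rw [abs_mul, abs_of_nonneg hr₁.1]
    have i1 := mul_le_of_le_one_left (abs_nonneg (∑ t ∈ Finset.Icc (2 : ℤ) n, g (t - 1))) hr₁.2
    linarith [main r₁ hr₁ r₂ hr₂]
  · rw [abs_mul, abs_of_nonneg q0]
    refine (mul_le_mul_of_nonneg_left hdr q0).trans ?_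
    rw [← mul_assoc]
    exact mul_le_of_le_one_left (by linarith) q1

end Deterministic

/-! ### Union bound over a finite class of predictable levels -/

section UnionBound

variable {Ω ι : Type*} {m0 : MeasurableSpace Ω} {P : Measure Ω} [IsProbabilityMeasure P]
  [Fintype ι] {ℱ : ℤ → MeasurableSpace Ω} {U : ℤ → Ω → ℝ} {thr : ι → ℤ → Ω → ℝ}

lemma measurable_lagWeight (hmono : ∀ t, ℱ t ≤ ℱ (t + 1))
    (hU : ∀ t, Measurable[ℱ (t + 1)] (U t)) {c : ℤ → Ω → ℝ} (hc : ∀ t, Measurable[ℱ t] (c t))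
    (t : ℤ) : Measurable[ℱ t] fun ω => lagWeight (fun s => U s ω) (fun s => c s ω) t := by
  unfold lagWeight
  split_ifs
  · exact measurable_const
  · have h1 := hU (t - 1)
    have h2 := hmono (t - 1)
    rw [sub_add_cancel] at h1 h2
    exact h1.ind ((hc (t - 1)).mono h2 le_rfl)

/-- With high probability all sums over a finite class of predictable levels are small. -/
lemma measure_not_smallSums_le (hle : ∀ t, ℱ t ≤ m0) (hmono : ∀ t, ℱ t ≤ ℱ (t + 1))
    (hU : ∀ t, Measurable[ℱ (t + 1)] (U t)) {n : ℕ}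
    (hunif : ∀ t ∈ Set.Icc (1 : ℤ) n, IsUniformGiven P (ℱ t) (U t))
    (hthr : ∀ i t, Measurable[ℱ t] (thr i t)) (hthrI : ∀ i t ω, thr i t ω ∈ Set.Icc (0 : ℝ) 1)
    {l : ℝ} (hl : 0 ≤ l) (hl' : l ≤ 1 / 2) (e v : ℝ) :
    P {ω | ¬ SmallSums (Set.range fun i t => thr i t ω) n (fun t => U t ω) e v}
      ≤ ((Fintype.card ι : ℝ≥0∞) ^ 2 + (Fintype.card ι : ℝ≥0∞) ^ 4)
        * (2 * ENNReal.ofReal (Real.exp (-(l * e) + 2 * l ^ 2 * v))) := by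
  set b : ℝ≥0∞ := 2 * ENNReal.ofReal (Real.exp (-(l * e) + 2 * l ^ 2 * v))
  let E₁ : ι × ι → Set Ω := fun q => {ω |
    e < |∑ t ∈ Finset.Icc (1 : ℤ) n, indIncr (U t ω) 1 1 (max (thr q.1 t ω) (thr q.2 t ω))
      (min (thr q.1 t ω) (thr q.2 t ω))| ∧
    ∑ t ∈ Finset.Icc (1 : ℤ) n, incrVar 1 1 (max (thr q.1 t ω) (thr q.2 t ω))
      (min (thr q.1 t ω) (thr q.2 t ω)) ≤ v}
  let W : ι → ℤ → Ω → ℝ := fun i t ω => lagWeight (fun s => U s ω) (fun s => thr i s ω) t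
  let E₂ : ι × ι × ι × ι → Set Ω := fun q => {ω |
    e < |∑ t ∈ Finset.Icc (1 : ℤ) n, indIncr (U t ω) (W q.2.2.1 t ω) (W q.2.2.2 t ω)
      (thr q.1 t ω) (thr q.2.1 t ω)| ∧
    ∑ t ∈ Finset.Icc (1 : ℤ) n, incrVar (W q.2.2.1 t ω) (W q.2.2.2 t ω)
      (thr q.1 t ω) (thr q.2.1 t ω) ≤ v}
  have h1 : ∀ q, P (E₁ q) ≤ b := fun q =>
    measure_lt_abs_sum_indIncr_le (w := fun _ _ => 1) (w' := fun _ _ => 1)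
      (a := fun t ω => max (thr q.1 t ω) (thr q.2 t ω))
      (b := fun t ω => min (thr q.1 t ω) (thr q.2 t ω)) hle hmono hU hunif
      (fun t => measurable_const) (fun t => measurable_const)
      (fun t => (hthr q.1 t).max (hthr q.2 t)) (fun t => (hthr q.1 t).min (hthr q.2 t))
      (fun _ _ => ⟨zero_le_one, le_rfl⟩) (fun _ _ => ⟨zero_le_one, le_rfl⟩)
      (fun t ω => ⟨le_max_of_le_left (hthrI q.1 t ω).1, max_le (hthrI q.1 t ω).2 (hthrI q.2 t ω).2⟩)
      (fun t ω => ⟨le_min (hthrI q.1 t ω).1 (hthrI q.2 t ω).1, min_le_of_left_le (hthrI q.1 t ω).2⟩)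
      hl hl' e v
  have h2 : ∀ q, P (E₂ q) ≤ b := fun q =>
    measure_lt_abs_sum_indIncr_le hle hmono hU hunif
      (measurable_lagWeight hmono hU (hthr q.2.2.1)) (measurable_lagWeight hmono hU (hthr q.2.2.2))
      (hthr q.1) (hthr q.2.1) (fun _ _ => lagWeight_mem _ _ _) (fun _ _ => lagWeight_mem _ _ _)
      (hthrI q.1) (hthrI q.2.1) hl hl' e v
  have hsub : {ω | ¬ SmallSums (Set.range fun i t => thr i t ω) n (fun t => U t ω) e v}
      ⊆ (⋃ q, E₁ q) ∪ ⋃ q, E₂ q := by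
    intro ω hω
    by_contra hcon
    rw [Set.mem_union, Set.mem_iUnion, Set.mem_iUnion, not_or, not_exists, not_exists] at hcon
    refine hω ⟨?_, ?_⟩
    · rintro _ ⟨i, rfl⟩ _ ⟨j, rfl⟩ hv
      by_contra! hlt
      exact hcon.1 (i, j) ⟨hlt, hv⟩
    · rintro _ ⟨i, rfl⟩ _ ⟨j, rfl⟩ _ ⟨k, rfl⟩ _ ⟨k', rfl⟩ hv
      by_contra! hlt
      exact hcon.2 (i, j, k, k') ⟨hlt, hv⟩
  -- Plain sums are indexed by pairs of levels and lagged ones by quadruples, hence the second and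
  -- fourth powers.
  refine (measure_mono hsub).trans ((measure_union_le _ _).trans ?_)
  rw [add_mul]
  refine add_le_add ?_ ?_
  · refine (measure_iUnion_fintype_le P E₁).trans
      ((Finset.sum_le_card_nsmul _ _ b fun q _ => h1 q).trans (le_of_eq ?_))
    rw [Finset.card_univ, Fintype.card_prod, nsmul_eq_mul]
    push_cast
    ring
  · refine (measure_iUnion_fintype_le P E₂).trans
      ((Finset.sum_le_card_nsmul _ _ b fun q _ => h2 q).trans (le_of_eq ?_))
    simp only [Finset.card_univ, Fintype.card_prod, nsmul_eq_mul]
    push_cast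
    ring

end UnionBound

/-! ### Cells, grid points and predictable bracketing levels -/

/-- The exponential inequality wants levels that are measurable for the past and in [0,1]
everywhere, while a supremum over a cell is only almost everywhere measurable for the law of the
past. Clamping a measurable version supplies both. -/
lemma exists_measurable_comap_version {Ω E : Type*} [MeasurableSpace Ω] [MeasurableSpace E]
    {P : Measure Ω} {X : Ω → E} (hX : Measurable X) {f : E → ℝ} (hf : AEMeasurable f (P.map X))
    (hfI : ∀ x, f x ∈ Set.Icc (0 : ℝ) 1) :
    ∃ g : Ω → ℝ, Measurable[MeasurableSpace.comap X inferInstance] g ∧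
      (∀ ω, g ω ∈ Set.Icc (0 : ℝ) 1) ∧ g =ᵐ[P] fun ω => f (X ω) := by
  refine ⟨fun ω => max 0 (min 1 (hf.mk f (X ω))), ?_, fun ω => ⟨le_max_left _ _,
    max_le zero_le_one (min_le_left _ _)⟩, ?_⟩
  · exact (measurable_const.max (measurable_const.min hf.measurable_mk)).comp
      (comap_measurable X)
  · filter_upwards [ae_of_ae_map hX.aemeasurable hf.ae_eq_mk] with ω hω
    rw [← hω, min_eq_right (hfI _).2, max_eq_right (hfI _).1]

/-- A bounded set in Euclidean space is covered by polynomially many small measurable cells. -/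
lemma exists_measurable_cells {L : ℕ} (Θ : Set (EuclideanSpace ℝ (Fin L))) (θ₀ : Θ) {ρ d : ℝ}
    (hd : 0 < d) {R : ℕ} (hR : ρ / d ≤ R) :
    ∃ C : (Fin L → Finset.Icc (-R : ℤ) R) → Set Θ, (∀ j, MeasurableSet (C j)) ∧
      (∀ j, C j ⊆ Metric.ball θ₀ ρ) ∧ (Metric.ball θ₀ ρ ⊆ ⋃ j, C j) ∧
      ∀ j, ∀ u ∈ C j, ∀ v ∈ C j, dist u v ≤ (L + 1) * d := by
  have hcoord : ∀ i : Fin L, Measurable fun u : Θ => ⌊((u : EuclideanSpace ℝ (Fin L)) i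
      - (θ₀ : EuclideanSpace ℝ (Fin L)) i) / d⌋ := by
    intro i
    refine Int.measurable_floor.comp (Measurable.div_const (Measurable.sub_const ?_ _) _)
    have : Continuous fun u : Θ => (u : EuclideanSpace ℝ (Fin L)) i := by fun_prop
    exact this.measurable
  -- A cell fixes the integer parts of the rescaled coordinates, so two of its points differ by at
  -- most d in each coordinate and by √L d ≤ (L + 1) d in norm. The factor L + 1 stays nonzero when
  -- L = 0.
  refine ⟨fun j => {u | dist u θ₀ < ρ ∧ ∀ i, ⌊((u : EuclideanSpace ℝ (Fin L)) i
      - (θ₀ : EuclideanSpace ℝ (Fin L)) i) / d⌋ = j i}, ?_, fun j u hu => hu.1, ?_, ?_⟩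
  · intro j
    refine (measurableSet_lt (continuous_id.dist continuous_const).measurable
      measurable_const).inter ?_
    have : {u : Θ | ∀ i, ⌊((u : EuclideanSpace ℝ (Fin L)) i
      - (θ₀ : EuclideanSpace ℝ (Fin L)) i) / d⌋ = j i} = ⋂ i, {u : Θ | ⌊((u : EuclideanSpace ℝ (Fin L)) i
      - (θ₀ : EuclideanSpace ℝ (Fin L)) i) / d⌋ = j i} := by
      ext u; simp
    change MeasurableSet {u : Θ | ∀ i, ⌊((u : EuclideanSpace ℝ (Fin L)) i
      - (θ₀ : EuclideanSpace ℝ (Fin L)) i) / d⌋ = j i}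
    rw [this]
    exact MeasurableSet.iInter fun i => hcoord i (measurableSet_singleton _)
  · intro u hu
    have hu' : dist u θ₀ < ρ := hu
    have hb : ∀ i, |((u : EuclideanSpace ℝ (Fin L)) i
        - (θ₀ : EuclideanSpace ℝ (Fin L)) i) / d| ≤ R := by
      intro i
      rw [abs_div, abs_of_pos hd]
      refine le_trans ?_ hR
      gcongr
      refine le_trans ?_ hu'.le
      have := PiLp.norm_apply_le ((u : EuclideanSpace ℝ (Fin L)) - (θ₀ : EuclideanSpace ℝ (Fin L))) i
      rwa [Real.norm_eq_abs, ← dist_eq_norm] at this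
    refine Set.mem_iUnion.2 ⟨fun i => ⟨⌊((u : EuclideanSpace ℝ (Fin L)) i
      - (θ₀ : EuclideanSpace ℝ (Fin L)) i) / d⌋, ?_⟩, hu', fun i => rfl⟩
    rw [Finset.mem_Icc]
    have := abs_le.1 (hb i)
    refine ⟨Int.le_floor.2 (by push_cast; exact this.1), ?_⟩
    have h2 := (Int.floor_le (((u : EuclideanSpace ℝ (Fin L)) i
      - (θ₀ : EuclideanSpace ℝ (Fin L)) i) / d)).trans this.2
    rw [← Int.cast_le (R := ℝ), Int.cast_natCast]
    exact h2
  · intro j u hu v hv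
    have hc : ∀ i, dist ((u : EuclideanSpace ℝ (Fin L)) i) ((v : EuclideanSpace ℝ (Fin L)) i) ≤ d := by
      intro i
      have h1 := Int.abs_sub_lt_one_of_floor_eq_floor ((hu.2 i).trans (hv.2 i).symm)
      rw [← sub_div, abs_div, abs_of_pos hd, div_lt_one hd, sub_sub_sub_cancel_right] at h1
      exact h1.le
    rw [Subtype.dist_eq, EuclideanSpace.dist_eq]
    refine Real.sqrt_le_iff.2 ⟨by positivity, ?_⟩
    have h2 : ∑ i, dist ((u : EuclideanSpace ℝ (Fin L)) i) ((v : EuclideanSpace ℝ (Fin L)) i) ^ 2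
        ≤ ∑ _i : Fin L, d ^ 2 := Finset.sum_le_sum fun i _ => by
      have := hc i
      gcongr
    refine h2.trans ?_
    rw [Finset.sum_const, Finset.card_univ, Fintype.card_fin, nsmul_eq_mul, mul_pow]
    have : (L : ℝ) ≤ ((L : ℝ) + 1) ^ 2 := by nlinarith [(Nat.cast_nonneg L : (0 : ℝ) ≤ L)]
    gcongr

/-- The oscillation of a bracket is controlled by the oscillations in the two arguments. -/
lemma ofReal_iSup_sub_iInf_le {T : Type*} {C B : Set T} (hne : C.Nonempty) (hCB : C ⊆ B)
    {f g : T → ℝ} {p : T → T → Prop} (hp : ∀ u ∈ C, ∀ v ∈ C, p u v) :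
    ENNReal.ofReal ((⨆ u : C, f u) - ⨅ u : C, g u)
      ≤ (⨆ u ∈ B, ⨆ v ∈ B, ⨆ _ : p u v, ENNReal.ofReal |f u - f v|)
        + ⨆ u ∈ B, ENNReal.ofReal |f u - g u| := by
  have : Nonempty C := hne.to_subtype
  set c := (⨆ u ∈ B, ⨆ v ∈ B, ⨆ _ : p u v, ENNReal.ofReal |f u - f v|)
        + ⨆ u ∈ B, ENNReal.ofReal |f u - g u| with hc
  rcases eq_or_ne c ⊤ with htop | htop
  · rw [htop]; exact le_top
  have key : ∀ u : C, ∀ v : C, f u - g v ≤ c.toReal := by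
    intro u v
    rw [← ENNReal.ofReal_le_iff_le_toReal htop]
    have h1 : ENNReal.ofReal |f u - f v|
        ≤ ⨆ u ∈ B, ⨆ v ∈ B, ⨆ _ : p u v, ENNReal.ofReal |f u - f v| :=
      le_iSup₂_of_le (u : T) (hCB u.2) (le_iSup₂_of_le (v : T) (hCB v.2)
        (le_iSup_of_le (hp u u.2 v v.2) le_rfl))
    have h2 : ENNReal.ofReal |f v - g v| ≤ ⨆ u ∈ B, ENNReal.ofReal |f u - g u| :=
      le_iSup₂_of_le (v : T) (hCB v.2) le_rfl
    refine le_trans ?_ (add_le_add h1 h2)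
    rw [← ENNReal.ofReal_add (abs_nonneg _) (abs_nonneg _)]
    refine ENNReal.ofReal_le_ofReal ?_
    linarith [le_abs_self (f u - f v), le_abs_self (f v - g v)]
  rw [ENNReal.ofReal_le_iff_le_toReal htop]
  have h1 : ∀ v : C, (⨆ u : C, f u) - c.toReal ≤ g v := fun v => by
    have : (⨆ u : C, f u) ≤ c.toReal + g v := ciSup_le fun u => by linarith [key u v]
    linarith
  linarith [le_ciInf h1]

lemma exists_fin_div_le_le {n : ℕ} (hn : 0 < n) {r : ℝ} (hr : r ∈ Set.Icc (0 : ℝ) 1) :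
    ∃ k : Fin n, (k : ℝ) / n ≤ r ∧ r ≤ ((k : ℝ) + 1) / n := by
  have hn' : (0 : ℝ) < n := by exact_mod_cast hn
  rcases hr.2.eq_or_lt with rfl | h1
  -- The endpoint 1 is put into the last interval, as its floor would be the excluded index n.
  · refine ⟨⟨n - 1, by omega⟩, ?_, ?_⟩
    · rw [div_le_one hn']
      exact_mod_cast Nat.sub_le n 1
    · rw [one_le_div hn']
      push_cast [Nat.cast_sub (show 1 ≤ n by omega)]
      linarith
  · have h0 : 0 ≤ r * n := mul_nonneg hr.1 hn'.le
    refine ⟨⟨⌊r * n⌋₊, (Nat.floor_lt h0).2 (by nlinarith)⟩, ?_, ?_⟩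
    · rw [div_le_iff₀ hn']; exact Nat.floor_le h0
    · rw [le_div_iff₀ hn']; exact (Nat.lt_floor_add_one _).le

lemma div_mem_Icc_of_fin {n : ℕ} (k : Fin n) : (k : ℝ) / n ∈ Set.Icc (0 : ℝ) 1 := by
  refine ⟨by positivity, div_le_one_of_le₀ ?_ (Nat.cast_nonneg _)⟩
  exact_mod_cast k.2.le

lemma add_one_div_mem_Icc_of_fin {n : ℕ} (k : Fin n) :
    ((k : ℝ) + 1) / n ∈ Set.Icc (0 : ℝ) 1 := by
  refine ⟨by positivity, div_le_one_of_le₀ ?_ (Nat.cast_nonneg _)⟩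
  exact_mod_cast k.2

lemma iSup_mem_Icc {T : Type*} {C : Set T} {f : T → ℝ} (hf : ∀ u, f u ∈ Set.Icc (0 : ℝ) 1) :
    (⨆ u : C, f u) ∈ Set.Icc (0 : ℝ) 1 :=
  ⟨Real.iSup_nonneg fun u => (hf u).1, Real.iSup_le (fun u => (hf u).2) zero_le_one⟩

lemma iInf_mem_Icc {T : Type*} {C : Set T} {f : T → ℝ} (hf : ∀ u, f u ∈ Set.Icc (0 : ℝ) 1) :
    (⨅ u : C, f u) ∈ Set.Icc (0 : ℝ) 1 := by
  refine ⟨Real.iInf_nonneg fun u => (hf u).1, ?_⟩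
  rcases isEmpty_or_nonempty C with h | ⟨⟨u⟩⟩
  · rw [Real.iInf_of_isEmpty]; exact zero_le_one
  · exact (ciInf_le ⟨0, by rintro _ ⟨v, rfl⟩; exact (hf v).1⟩ u).trans (hf u).2

section Past

variable {Ω : Type*} {Y : ℤ → Ω → ℝ}

lemma measurable_past [MeasurableSpace Ω] (hY : ∀ t, Measurable (Y t)) (t : ℤ) :
    Measurable (past Y t) := measurable_pi_lambda _ fun _ => hY _

lemma info_mono (Y : ℤ → Ω → ℝ) (t : ℤ) : info Y t ≤ info Y (t + 1) := by
  have h : past Y t = (fun x : ℕ → ℝ => fun k => x (k + 1)) ∘ past Y (t + 1) := by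
    ext ω k
    show Y (t - 1 - (k : ℤ)) ω = Y (t + 1 - 1 - ((k + 1 : ℕ) : ℤ)) ω
    rw [show t + 1 - 1 - ((k + 1 : ℕ) : ℤ) = t - 1 - k by push_cast; ring]
  have hm : Measurable fun x : ℕ → ℝ => fun k : ℕ => x (k + 1) :=
    measurable_pi_lambda _ fun _ => measurable_pi_apply _
  refine measurable_iff_comap_le.1 ?_
  rw [h]
  exact hm.comp (comap_measurable _)

lemma measurable_info_succ (Y : ℤ → Ω → ℝ) (t : ℤ) : Measurable[info Y (t + 1)] (Y t) := by
  have h : Y t = (fun x : ℕ → ℝ => x 0) ∘ past Y (t + 1) := by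
    ext ω; simp [past]
  rw [h]
  exact (measurable_pi_apply 0).comp (comap_measurable _)

end Past

/-- The bracketing levels: brackets over the cells `C j` and the grid points `k / n`. -/
noncomputable def bracketLevel {T J : Type*} (C : J → Set T) (n : ℕ)
    (h : ℤ → (ℕ → ℝ) → ℝ → T → ℝ) :
    (J × Fin n × Bool) ⊕ (Fin n × Bool) → ℤ → (ℕ → ℝ) → ℝ
  | Sum.inl (j, k, true), t, x => ⨆ u : C j, h t x (((k : ℝ) + 1) / n) u
  | Sum.inl (j, k, false), t, x => ⨅ u : C j, h t x ((k : ℝ) / n) u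
  | Sum.inr (k, true), _, _ => ((k : ℝ) + 1) / n
  | Sum.inr (k, false), _, _ => (k : ℝ) / n

lemma bracketLevel_mem {T J : Type*} (C : J → Set T) (n : ℕ) {h : ℤ → (ℕ → ℝ) → ℝ → T → ℝ}
    (hI : ∀ t x r u, h t x r u ∈ Set.Icc (0 : ℝ) 1) :
    ∀ i t x, bracketLevel C n h i t x ∈ Set.Icc (0 : ℝ) 1
  | Sum.inl (_, _, true), t, x => iSup_mem_Icc (hI t x _)
  | Sum.inl (_, _, false), t, x => iInf_mem_Icc (hI t x _)
  | Sum.inr (k, true), _, _ => add_one_div_mem_Icc_of_fin k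
  | Sum.inr (k, false), _, _ => div_mem_Icc_of_fin k

lemma aemeasurable_bracketLevel {T J : Type*} [MeasurableSpace T] [StandardBorelSpace T]
    {C : J → Set T} (hC : ∀ j, MeasurableSet (C j)) (n : ℕ) {h : ℤ → (ℕ → ℝ) → ℝ → T → ℝ}
    (hI : ∀ t x r u, h t x r u ∈ Set.Icc (0 : ℝ) 1)
    (hm : ∀ t, ∀ r ∈ Set.Icc (0 : ℝ) 1, Measurable fun p : (ℕ → ℝ) × T => h t p.1 r p.2)
    (μ : Measure (ℕ → ℝ)) [IsFiniteMeasure μ] :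
    ∀ i t, AEMeasurable (bracketLevel C n h i t) μ
  | Sum.inl (j, k, true), t => by
    rcases (C j).eq_empty_or_nonempty with he | hne
    · have : IsEmpty (C j) := Set.isEmpty_coe_sort.2 he
      have h0 : bracketLevel C n h (Sum.inl (j, k, true)) t = fun _ => 0 :=
        funext fun _ => Real.iSup_of_isEmpty _
      rw [h0]
      exact aemeasurable_const
    · exact aemeasurable_iSup_of_measurable_prod μ (hm t _ (add_one_div_mem_Icc_of_fin k)) (hC j)
        hne fun x => ⟨1, by rintro _ ⟨u, rfl⟩; exact (hI t x _ u).2⟩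
  | Sum.inl (j, k, false), t => by
    rcases (C j).eq_empty_or_nonempty with he | hne
    · have : IsEmpty (C j) := Set.isEmpty_coe_sort.2 he
      have h0 : bracketLevel C n h (Sum.inl (j, k, false)) t = fun _ => 0 :=
        funext fun _ => Real.iInf_of_isEmpty _
      rw [h0]
      exact aemeasurable_const
    · exact aemeasurable_iInf_of_measurable_prod μ (hm t _ (div_mem_Icc_of_fin k)) (hC j)
        hne fun x => ⟨0, by rintro _ ⟨u, rfl⟩; exact (hI t x _ u).1⟩
  | Sum.inr (_, true), _ => aemeasurable_const
  | Sum.inr (_, false), _ => aemeasurable_const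

/-! ### The non-asymptotic expansion -/

/-- The non-asymptotic form of the uniform expansion. -/
lemma measure_expansion_error_le {L : ℕ} (Θ : Set (EuclideanSpace ℝ (Fin L)))
    (hΘ : MeasurableSet Θ) (F : ℤ → (ℕ → ℝ) → Θ → ℝ → ℝ) (H : ℤ → (ℕ → ℝ) → ℝ → ℝ)
    (hF : ∀ t x θ, IsStrictCDF (F t x θ)) (hH : ∀ t x, IsStrictCDF (H t x))
    (hFm : ∀ t y, Measurable fun p : (ℕ → ℝ) × Θ => F t p.1 p.2 y)
    (hHm : ∀ t y, Measurable fun x : ℕ → ℝ => H t x y)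
    {Ω : Type*} [MeasurableSpace Ω] (P : Measure Ω) [IsProbabilityMeasure P]
    (Y : ℤ → Ω → ℝ) (hY : ∀ t, Measurable (Y t)) (θ₀ : Θ) (θhat : Ω → Θ) {δ : ℝ} {n : ℕ}
    (hn : 2 ≤ n) (hδ0 : 0 ≤ δ) (hδ1 : δ ≤ √(n : ℝ))
    (hdata : ∀ t ∈ Set.Icc (1 : ℤ) n, ∀ y : ℝ,
      P[Set.indicator {ω | Y t ω ≤ y} (fun _ => (1 : ℝ)) | info Y t]
        =ᵐ[P] fun ω => mixCDF F H δ n t (past Y t ω) θ₀ y)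
    {ρ k e e' v v' l : ℝ} {R : ℕ} (hR : ρ * (n * (L + 1)) ≤ R) (hl : 0 ≤ l) (hl' : l ≤ 1 / 2)
    (hk : 0 ≤ k) (he' : 1 ≤ e') (hv : 2 * v' + e ≤ v) (hv' : v' ≤ v)
    (hw : n * k + 2 * e' ≤ v') :
    P {ω | dist (θhat ω) θ₀ < ρ ∧
      (∀ r ∈ Set.Icc (0 : ℝ) 1, ∀ t ∈ Set.Icc (1 : ℤ) n,
        |eta F H δ n θ₀ t (past Y t ω) r (θhat ω) - r| ≤ k) ∧
      (∀ r ∈ Set.Icc (0 : ℝ) 1, ∑ t ∈ Finset.Icc (1 : ℤ) n,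
        ⨆ u ∈ Metric.ball θ₀ ρ, ⨆ u' ∈ Metric.ball θ₀ ρ, ⨆ _ : dist u u' ≤ 1 / n,
          ENNReal.ofReal |eta F H δ n θ₀ t (past Y t ω) r u
            - eta F H δ n θ₀ t (past Y t ω) r u'| ≤ ENNReal.ofReal (e' / 2)) ∧
      (∀ r ∈ Set.Icc (0 : ℝ) 1, ∀ s ∈ Set.Icc (0 : ℝ) 1, |r - s| ≤ 1 / n →
        ∑ t ∈ Finset.Icc (1 : ℤ) n, ⨆ u ∈ Metric.ball θ₀ ρ,
          ENNReal.ofReal |eta F H δ n θ₀ t (past Y t ω) r u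
            - eta F H δ n θ₀ t (past Y t ω) s u| ≤ ENNReal.ofReal (e' / 2)) ∧
      ∃ r₁ ∈ Set.Icc (0 : ℝ) 1, ∃ r₂ ∈ Set.Icc (0 : ℝ) 1,
        1 / √((n : ℝ) - 1) * (2 * (3 * e + 4 * e') + 4) + 2 * k <
        |empProc n (fun t => F t (past Y t ω) (θhat ω) (Y t ω)) r₁ r₂
          - empProc n (fun t => mixCDF F H δ n t (past Y t ω) θ₀ (Y t ω)) r₁ r₂
          - drift n (fun t => mixCDF F H δ n t (past Y t ω) θ₀ (Y t ω))
            (fun t r => eta F H δ n θ₀ t (past Y t ω) r (θhat ω)) r₁ r₂|}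
      ≤ ((((2 * R + 1) ^ L * (n * 2) + n * 2 : ℕ) : ℝ≥0∞) ^ 2
          + (((2 * R + 1) ^ L * (n * 2) + n * 2 : ℕ) : ℝ≥0∞) ^ 4)
        * (2 * ENNReal.ofReal (Real.exp (-(l * e) + 2 * l ^ 2 * v))) := by
  have hn0 : (0 : ℝ) < n := by exact_mod_cast (by omega : 0 < n)
  have : StandardBorelSpace Θ := hΘ.standardBorel
  have hG : ∀ t x, IsStrictCDF (mixCDF F H δ n t x θ₀) := fun t x =>
    isStrictCDF_mixCDF hF hH hδ0 hδ1 t x θ₀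
  have hGm := fun t => measurable_mixCDF hFm hHm δ n t θ₀
  have hηI : ∀ t x r u, eta F H δ n θ₀ t x r u ∈ Set.Icc (0 : ℝ) 1 := fun t x r u =>
    extCDF_quantile_mem (hG t x) r
  have hηmono : ∀ t x u, Monotone fun r => eta F H δ n θ₀ t x r u := fun t x u =>
    (monotone_extCDF (hG t x)).comp (monotone_quantile _)
  have hηm : ∀ t, ∀ r ∈ Set.Icc (0 : ℝ) 1,
      Measurable fun p : (ℕ → ℝ) × Θ => eta F H δ n θ₀ t p.1 r p.2 := fun t r hr =>
    measurable_eta hF hFm hHm (hG t) hr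
  have hX := measurable_past hY
  let U : ℤ → Ω → ℝ := fun t ω => mixCDF F H δ n t (past Y t ω) θ₀ (Y t ω)
  have hU : ∀ t, Measurable[info Y (t + 1)] (U t) := fun t =>
    (measurable_uncurry_of_isStrictCDF (hG t) (hGm t)).comp
      (((comap_measurable (past Y t)).mono (info_mono Y t) le_rfl).prodMk
        (measurable_info_succ Y t))
  have hunif : ∀ t ∈ Set.Icc (1 : ℤ) n, IsUniformGiven P (info Y t) (U t) := fun t ht =>
    isUniformGiven_of_condCDF (hX t) (hY t) (hG t) (hGm t) (hdata t ht)
  have hd : (0 : ℝ) < 1 / (n * (L + 1)) := by positivity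
  obtain ⟨C, hCm, hCB, hcov, hCd⟩ := exists_measurable_cells Θ θ₀ (ρ := ρ) hd (R := R)
    (by rwa [div_div_eq_mul_div, div_one])
  have hCd' : ∀ j, ∀ u ∈ C j, ∀ u' ∈ C j, dist u u' ≤ 1 / (n : ℝ) := by
    intro j u hu u' hu'
    refine (hCd j u hu u' hu').trans (le_of_eq ?_)
    field_simp
  let lev := bracketLevel C n fun t x r u => eta F H δ n θ₀ t x r u
  have hlevI := bracketLevel_mem C n hηI
  have hver : ∀ i t, ∃ g : Ω → ℝ, Measurable[info Y t] g ∧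
      (∀ ω, g ω ∈ Set.Icc (0 : ℝ) 1) ∧ g =ᵐ[P] fun ω => lev i t (past Y t ω) := fun i t =>
    have : IsProbabilityMeasure (P.map (past Y t)) :=
      Measure.isProbabilityMeasure_map (hX t).aemeasurable
    exists_measurable_comap_version (hX t)
      (aemeasurable_bracketLevel hCm n hηI hηm _ i t) (hlevI i t)
  choose thr hthr hthrI hthrE using hver
  have hae : ∀ᵐ ω ∂P, ∀ i t, thr i t ω = lev i t (past Y t ω) := by
    rw [ae_all_iff]
    intro i
    rw [ae_all_iff]
    exact fun t => hthrE i t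
  have hbound := measure_not_smallSums_le (P := P) (n := n) (fun t => (hX t).comap_le)
    (info_mono Y) hU hunif hthr hthrI hl hl' e v
  have hcard : Fintype.card (((Fin L → Finset.Icc (-R : ℤ) R) × Fin n × Bool) ⊕ (Fin n × Bool))
      = (2 * R + 1) ^ L * (n * 2) + n * 2 := by
    have : ((R : ℤ) + 1 + R).toNat = 2 * R + 1 := by omega
    simp [this]
  rw [hcard] at hbound
  -- Off the null set where a version differs from its level, the event forces `SmallSums` to fail.
  -- Only monotonicity of the outer measure is needed, so the event may be nonmeasurable.
  refine le_trans (measure_mono_ae ?_) hbound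
  filter_upwards [hae] with ω hω
  rintro ⟨hball, hc1, hc2, hc3, r₁, hr₁, r₂, hr₂, hlt⟩ hsmall
  refine absurd hlt (not_lt.2 ?_)
  -- For the brackets the estimator matters only through the choice of the cell, and `SmallSums`
  -- covers all cells at once.
  obtain ⟨j, hj⟩ := Set.mem_iUnion.1 (hcov (show θhat ω ∈ Metric.ball θ₀ ρ from hball))
  have hwidth : ∀ k : Fin n, |((k : ℝ) + 1) / n - (k : ℝ) / n| = 1 / n := by
    intro k
    rw [← sub_div, add_sub_cancel_left, abs_of_nonneg (by positivity)]
  refine hsmall.abs_empProc_sub_le hn hv hv' hk hw (by linarith) ?_ ?_ ?_ ?_ ?_ ?_ ?_ hr₁ hr₂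
  · intro t _ r hr
    exact ind_congr (le_iff_le_extCDF_quantile (hF _ _ _) (hG _ _) hr _)
  · exact fun t => ((hG t _).lt_one _).le
  · exact fun t => extCDF_quantile_one (hF _ _ _)
  · exact fun t r => hηI _ _ _ _
  · intro t ht r hr
    rw [Finset.mem_Icc] at ht
    exact hc1 r hr t ht
  · intro r hr
    obtain ⟨k, hk1, hk2⟩ := exists_fin_div_le_le (by omega : 0 < n) hr
    refine ⟨fun t => thr (Sum.inl (j, k, false)) t ω, fun t => thr (Sum.inl (j, k, true)) t ω,
      ⟨_, rfl⟩, ⟨_, rfl⟩, fun t _ => (hthrI _ t ω).1, fun t _ => ?_, fun t _ => ?_,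
      fun t _ => (hthrI _ t ω).2, ?_⟩
    · rw [hω]
      refine le_trans (ciInf_le ⟨0, ?_⟩ (⟨θhat ω, hj⟩ : C j)) (hηmono t _ _ hk1)
      rintro _ ⟨u, rfl⟩
      exact (hηI _ _ _ _).1
    · rw [hω]
      refine le_trans (hηmono t _ _ hk2) (le_ciSup (f := fun u : C j =>
        eta F H δ n θ₀ t (past Y t ω) (((k : ℝ) + 1) / n) u) ⟨1, ?_⟩ (⟨θhat ω, hj⟩ : C j))
      rintro _ ⟨u, rfl⟩
      exact (hηI _ _ _ _).2
    · have hnn : ∀ t ∈ Finset.Icc (1 : ℤ) n,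
          0 ≤ thr (Sum.inl (j, k, true)) t ω - thr (Sum.inl (j, k, false)) t ω := by
        intro t _
        rw [hω, hω, sub_nonneg]
        refine le_trans (ciInf_le ⟨0, ?_⟩ (⟨θhat ω, hj⟩ : C j))
          (le_trans (hηmono t _ _ (hk1.trans hk2)) (le_ciSup (f := fun u : C j =>
          eta F H δ n θ₀ t (past Y t ω) (((k : ℝ) + 1) / n) u) ⟨1, ?_⟩ (⟨θhat ω, hj⟩ : C j)))
        · rintro _ ⟨u, rfl⟩
          exact (hηI _ _ _ _).1
        · rintro _ ⟨u, rfl⟩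
          exact (hηI _ _ _ _).2
      rw [← ENNReal.ofReal_le_ofReal_iff (by linarith), ENNReal.ofReal_sum_of_nonneg hnn]
      -- The width is the oscillation over the cell at level (k + 1)/n plus the change between the
      -- grid levels, e'/2 each.
      have h2 := hc2 _ (add_one_div_mem_Icc_of_fin k)
      have h3 := hc3 _ (add_one_div_mem_Icc_of_fin k) _ (div_mem_Icc_of_fin k) (hwidth k).le
      rw [show e' = e' / 2 + e' / 2 by ring, ENNReal.ofReal_add (by linarith) (by linarith)]
      refine le_trans ?_ (add_le_add h2 h3)
      rw [← Finset.sum_add_distrib]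
      refine Finset.sum_le_sum fun t _ => ?_
      rw [hω, hω]
      exact ofReal_iSup_sub_iInf_le ⟨_, hj⟩ (hCB j) (hCd' j)
  · intro r hr
    obtain ⟨k, hk1, hk2⟩ := exists_fin_div_le_le (by omega : 0 < n) hr
    refine ⟨fun t => thr (Sum.inr (k, false)) t ω, fun t => thr (Sum.inr (k, true)) t ω,
      ⟨_, rfl⟩, ⟨_, rfl⟩, fun t _ => (hthrI _ t ω).1, fun t _ => ?_, fun t _ => ?_,
      fun t _ => (hthrI _ t ω).2, ?_⟩
    · rw [hω]; exact hk1
    · rw [hω]; exact hk2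
    -- A constant bracket has n widths of 1/n, in total exactly 1; this is why `1 ≤ e'` is required.
    · refine le_trans (le_of_eq ?_) he'
      have : ∀ t ∈ Finset.Icc (1 : ℤ) n,
          thr (Sum.inr (k, true)) t ω - thr (Sum.inr (k, false)) t ω = 1 / n := by
        intro t _
        rw [hω, hω, ← hwidth k, abs_of_nonneg]
        · rfl
        · exact sub_nonneg.2 (hk1.trans hk2)
      rw [Finset.sum_congr rfl this, Finset.sum_const, nsmul_eq_mul, Int.card_Icc]
      simp only [add_sub_cancel_right, Int.toNat_natCast]
      field_simp

/-! ### Passage to the limit -/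

/-- Polynomially many events of probability `exp (-c √n)` are negligible. -/
lemma tendsto_card_mul_exp_neg_sqrt (D L : ℕ) {c : ℝ} (hc : 0 < c) :
    Tendsto (fun n : ℕ =>
      ((((2 * (D * n) + 1) ^ L * (n * 2) + n * 2 : ℕ) : ℝ≥0∞) ^ 2
          + (((2 * (D * n) + 1) ^ L * (n * 2) + n * 2 : ℕ) : ℝ≥0∞) ^ 4)
        * (2 * ENNReal.ofReal (Real.exp (-(c * √(n : ℝ)))))) atTop (𝓝 0) := by
  set B : ℕ := 2 * (2 * D + 1) ^ L + 2
  -- N⁴ is of order n^(4(L + 1)), written as a power of √n to match x^s exp(-cx) → 0.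
  have hlim : Tendsto (fun n : ℕ => (4 * (B : ℝ) ^ 4) *
      (√(n : ℝ) ^ ((2 * (4 * (L + 1)) : ℕ) : ℝ) * Real.exp (-c * √(n : ℝ)))) atTop (𝓝 0) := by
    rw [← mul_zero (4 * (B : ℝ) ^ 4)]
    exact ((tendsto_rpow_mul_exp_neg_mul_atTop_nhds_zero _ c hc).comp
      (Real.tendsto_sqrt_atTop.comp tendsto_natCast_atTop_atTop)).const_mul _
  have hlim' := ENNReal.tendsto_ofReal hlim
  rw [ENNReal.ofReal_zero] at hlim'
  refine tendsto_of_tendsto_of_tendsto_of_le_of_le' tendsto_const_nhds hlim'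
    (Eventually.of_forall fun _ => zero_le) ?_
  filter_upwards [eventually_ge_atTop 1] with n hn
  set N : ℕ := (2 * (D * n) + 1) ^ L * (n * 2) + n * 2 with hN
  have hNB : N ≤ B * n ^ (L + 1) := by
    have h1 : 2 * (D * n) + 1 ≤ (2 * D + 1) * n := by nlinarith
    have h2 : (2 * (D * n) + 1) ^ L ≤ (2 * D + 1) ^ L * n ^ L := by
      rw [← mul_pow]; exact Nat.pow_le_pow_left h1 L
    have h3 : n ≤ n ^ (L + 1) := Nat.le_self_pow (by omega) n
    calc N ≤ (2 * D + 1) ^ L * n ^ L * (n * 2) + n ^ (L + 1) * 2 := by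
          rw [hN]; gcongr
      _ = B * n ^ (L + 1) := by simp only [B]; ring
  have hN1 : 1 ≤ N := by rw [hN]; omega
  have hpoly : N ^ 2 + N ^ 4 ≤ 2 * (B * n ^ (L + 1)) ^ 4 := by
    have h1 : N ^ 2 ≤ N ^ 4 := Nat.pow_le_pow_right hN1 (by norm_num)
    have h2 : N ^ 4 ≤ (B * n ^ (L + 1)) ^ 4 := Nat.pow_le_pow_left hNB 4
    omega
  have hpolyR : ((N : ℝ) ^ 2 + (N : ℝ) ^ 4) ≤ 2 * ((B : ℝ) ^ 4 * (n : ℝ) ^ (4 * (L + 1))) := by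
    have : ((N : ℝ) ^ 2 + (N : ℝ) ^ 4) ≤ 2 * ((B : ℝ) * (n : ℝ) ^ (L + 1)) ^ 4 := by
      exact_mod_cast hpoly
    refine this.trans (le_of_eq ?_)
    ring
  have hsq : √(n : ℝ) ^ ((2 * (4 * (L + 1)) : ℕ) : ℝ) = (n : ℝ) ^ (4 * (L + 1)) := by
    rw [Real.rpow_natCast, pow_mul, Real.sq_sqrt (Nat.cast_nonneg n)]
  have hcast : ((N : ℝ≥0∞) ^ 2 + (N : ℝ≥0∞) ^ 4) = ENNReal.ofReal ((N : ℝ) ^ 2 + (N : ℝ) ^ 4) := by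
    rw [ENNReal.ofReal_add (by positivity) (by positivity),
      ENNReal.ofReal_pow (Nat.cast_nonneg _), ENNReal.ofReal_pow (Nat.cast_nonneg _),
      ENNReal.ofReal_natCast]
  rw [hcast, show (2 : ℝ≥0∞) = ENNReal.ofReal 2 by simp, ← ENNReal.ofReal_mul (by norm_num),
    ← ENNReal.ofReal_mul (by positivity), hsq]
  refine ENNReal.ofReal_le_ofReal ?_
  rw [neg_mul]
  have := mul_le_mul_of_nonneg_right hpolyR (Real.exp_pos (-(c * √(n : ℝ)))).le
  linarith

lemma rpow_neg_half_eq (n : ℕ) : (n : ℝ) ^ (-(1 / 2) : ℝ) = 1 / √(n : ℝ) := by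
  rw [Real.rpow_neg (Nat.cast_nonneg n), ← Real.sqrt_eq_rpow, one_div]

lemma ofReal_one_div_sqrt_mul_le {n : ℕ} (hn : 0 < n) {x : ℝ} {S : ℝ≥0∞}
    (h : ENNReal.ofReal (1 / √(n : ℝ)) * S ≤ ENNReal.ofReal x) :
    S ≤ ENNReal.ofReal (x * √(n : ℝ)) := by
  have hs : 0 < √(n : ℝ) := Real.sqrt_pos.2 (by exact_mod_cast hn)
  have h1 : ENNReal.ofReal (√(n : ℝ)) * ENNReal.ofReal (1 / √(n : ℝ)) = 1 := by
    rw [← ENNReal.ofReal_mul hs.le, mul_one_div_cancel hs.ne', ENNReal.ofReal_one]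
  calc S = ENNReal.ofReal (√(n : ℝ)) * (ENNReal.ofReal (1 / √(n : ℝ)) * S) := by
        rw [← mul_assoc, h1, one_mul]
    _ ≤ ENNReal.ofReal (√(n : ℝ)) * ENNReal.ofReal x := by gcongr
    _ = _ := by rw [← ENNReal.ofReal_mul hs.le, mul_comm]

theorem mainTheorem6
    -- the parameter space, a Borel subset of Euclidean space
    {L : ℕ} (Θ : Set (EuclideanSpace ℝ (Fin L))) (hΘ : MeasurableSet Θ)
    -- the parametric family and the alternative: conditional cdfs as functions of the past
    (F : ℤ → (ℕ → ℝ) → Θ → ℝ → ℝ) (H : ℤ → (ℕ → ℝ) → ℝ → ℝ)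
    (hF : ∀ t x θ, IsStrictCDF (F t x θ)) (hH : ∀ t x, IsStrictCDF (H t x))
    (hFm : ∀ t y, Measurable fun p : (ℕ → ℝ) × Θ => F t p.1 p.2 y)
    (hHm : ∀ t y, Measurable fun x : ℕ → ℝ => H t x y)
    -- the triangular array of time series
    {Ω : ℕ → Type*} [∀ n, MeasurableSpace (Ω n)]
    (P : ∀ n, Measure (Ω n)) [∀ n, IsProbabilityMeasure (P n)]
    (Y : ∀ n, ℤ → Ω n → ℝ) (hY : ∀ n t, Measurable (Y n t))
    -- the true parameters, the estimators and the distance from the family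
    (θ : ℕ → Θ) (θhat : ∀ n, Ω n → Θ)
    (δ : ℕ → ℝ) (hδ : ∀ᶠ n : ℕ in atTop, 0 ≤ δ n ∧ δ n ≤ √(n : ℝ))
    -- the data are generated under `G_{nt}( · | θ_n)`
    (hdata : ∀ᶠ n : ℕ in atTop, ∀ t ∈ Set.Icc (1 : ℤ) n, ∀ y : ℝ,
      (P n)[Set.indicator {ω | Y n t ω ≤ y} (fun _ => (1 : ℝ)) | info (Y n) t]
        =ᵐ[P n] fun ω => mixCDF F H (δ n) n t (past (Y n) t ω) (θ n) y)
    -- the estimator is root-n consistent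
    (hest : IsBigOP P
      (fun n ω => ENNReal.ofReal (√(n : ℝ) * dist (θhat n ω) (θ n))) (fun _ => 1))
    -- (C1)
    (hC1 : IsBigOP P
      (fun n ω => ⨆ r ∈ Set.Icc (0 : ℝ) 1, ⨆ t ∈ Set.Icc (1 : ℤ) n,
        ENNReal.ofReal
          |eta F H (δ n) n (θ n) t (past (Y n) t ω) r (θhat n ω) - r|)
      (fun n => (n : ℝ) ^ (-(1 / 2) : ℝ)))
    -- (C2)
    (hC2 : ∀ M M₂ κ : ℝ, 0 < M → 0 < M₂ → 0 < κ → IsLittleOP P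
      (fun n ω => ⨆ r ∈ Set.Icc (0 : ℝ) 1,
        ENNReal.ofReal (1 / √(n : ℝ)) * ∑ t ∈ Finset.Icc (1 : ℤ) n,
          ⨆ u ∈ Metric.ball (θ n) (M * (n : ℝ) ^ (-(1 / 2) : ℝ)),
          ⨆ v ∈ Metric.ball (θ n) (M * (n : ℝ) ^ (-(1 / 2) : ℝ)),
          ⨆ _ : dist u v ≤ M₂ * (n : ℝ) ^ (-(1 / 2) - κ : ℝ),
            ENNReal.ofReal
              |eta F H (δ n) n (θ n) t (past (Y n) t ω) r u
                - eta F H (δ n) n (θ n) t (past (Y n) t ω) r v|))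
    -- (C3)
    (hC3 : ∀ M M₂ κ : ℝ, 0 < M → 0 < M₂ → 0 < κ → IsLittleOP P
      (fun n ω => ⨆ r ∈ Set.Icc (0 : ℝ) 1, ⨆ s ∈ Set.Icc (0 : ℝ) 1,
        ⨆ _ : |r - s| ≤ M₂ * (n : ℝ) ^ (-(1 / 2) - κ : ℝ),
        ENNReal.ofReal (1 / √(n : ℝ)) * ∑ t ∈ Finset.Icc (1 : ℤ) n,
          ⨆ u ∈ Metric.ball (θ n) (M * (n : ℝ) ^ (-(1 / 2) : ℝ)),
            ENNReal.ofReal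
              |eta F H (δ n) n (θ n) t (past (Y n) t ω) r u
                - eta F H (δ n) n (θ n) t (past (Y n) t ω) s u|)) :
    IsLittleOP P (fun n ω =>
      -- `Uhat` are the estimated transforms and `U` the transforms under the true distribution
      let Uhat : ℤ → ℝ := fun t => F t (past (Y n) t ω) (θhat n ω) (Y n t ω)
      let U : ℤ → ℝ := fun t => mixCDF F H (δ n) n t (past (Y n) t ω) (θ n) (Y n t ω)
      let η : ℤ → ℝ → ℝ := fun t r =>
        eta F H (δ n) n (θ n) t (past (Y n) t ω) r (θhat n ω)
      ⨆ r₁ ∈ Set.Icc (0 : ℝ) 1, ⨆ r₂ ∈ Set.Icc (0 : ℝ) 1,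
        ENNReal.ofReal |empProc n Uhat r₁ r₂ - empProc n U r₁ r₂ - drift n U η r₁ r₂|) := by
  intro ε hε
  rw [ENNReal.tendsto_nhds_zero]
  intro ζ hζ
  -- Five exceptional events share ζ: the estimator, the three conditions, and failure of the
  -- expansion.
  obtain ⟨z, -, hz0, hzζ⟩ : ∃ z : ℝ, 0 ≤ z ∧ 0 < ENNReal.ofReal z ∧ ENNReal.ofReal z < ζ / 5 :=
    ENNReal.lt_iff_exists_real_btwn.1 (ENNReal.div_pos hζ.ne' (by norm_num))
  have hz : 0 < z := ENNReal.ofReal_pos.1 hz0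
  obtain ⟨Ke, hKe⟩ := hest z hz
  obtain ⟨K₁, hK₁⟩ := hC1 z hz
  set M : ℝ := |Ke| + 1
  have hM : 0 < M := by positivity
  set K : ℝ := |K₁|
  have hK : 0 ≤ K := abs_nonneg _
  -- With e = e' = ε₀√n and 1/√(n - 1) ≤ 2/√n, the leading error is 2·2·(3 + 4)ε₀ = 28ε₀, at most
  -- ε/2. The cap 1 gives e ≤ √n.
  set ε₀ : ℝ := min (ε / 56) 1
  have hε₀ : 0 < ε₀ := lt_min (by positivity) one_pos
  have hε₀1 : ε₀ ≤ 1 := min_le_right _ _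
  have hε₀ε : 28 * ε₀ ≤ ε / 2 := by
    have : ε₀ ≤ ε / 56 := min_le_left _ _
    linarith
  -- For v' = (K + 2)√n and e ≤ √n, the variation 2v' + e is at most A√n.
  set A : ℝ := 2 * K + 5
  have hA : 0 < A := by positivity
  -- Gives 2l²A ≤ lε₀/2, so the exponential rate in `hc` is positive.
  set l : ℝ := min (1 / 2) (ε₀ / (4 * A))
  have hl : 0 < l := lt_min (by norm_num) (by positivity)
  have hlA : l * (4 * A) ≤ ε₀ := (le_div_iff₀ (by positivity)).1 (min_le_right _ _)
  have hc : 0 < l * ε₀ - 2 * l ^ 2 * A := by nlinarith [mul_pos hl hε₀]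
  set D : ℕ := ⌈M * (L + 1)⌉₊
  have hsqrt : Tendsto (fun n : ℕ => √(n : ℝ)) atTop atTop :=
    Real.tendsto_sqrt_atTop.comp tendsto_natCast_atTop_atTop
  have hbad := (ENNReal.tendsto_nhds_zero.1 (tendsto_card_mul_exp_neg_sqrt D L hc)) _ hz0
  -- Taking κ = 1/2 and M₂ = 1 makes the permitted distance exactly the mesh 1/n.
  have hC2' := (ENNReal.tendsto_nhds_zero.1 (hC2 M 1 (1 / 2) hM one_pos (by norm_num) (ε₀ / 2)
    (by positivity))) _ hz0
  have hC3' := (ENNReal.tendsto_nhds_zero.1 (hC3 M 1 (1 / 2) hM one_pos (by norm_num) (ε₀ / 2)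
    (by positivity))) _ hz0
  filter_upwards [hδ, hdata, hKe, hK₁, hC2', hC3', hbad, eventually_ge_atTop 2,
    hsqrt.eventually_ge_atTop (1 / ε₀), hsqrt.eventually_ge_atTop ((8 + 2 * K) * 2 / ε)]
    with n hδn hdatan hKen hK₁n hC2n hC3n hbadn hn hn1 hn2
  have hn0 : (0 : ℝ) < n := by exact_mod_cast (by omega : 0 < n)
  have hs : 0 < √(n : ℝ) := Real.sqrt_pos.2 hn0
  have hss : √(n : ℝ) * √(n : ℝ) = n := Real.mul_self_sqrt hn0.le
  have hmesh : (1 : ℝ) * (n : ℝ) ^ (-(1 / 2) - 1 / 2 : ℝ) = 1 / n := by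
    rw [show (-(1 / 2) - 1 / 2 : ℝ) = -1 by norm_num, Real.rpow_neg_one, one_mul, one_div]
  simp only [hmesh] at hC2n hC3n
  set ρ : ℝ := M * (n : ℝ) ^ (-(1 / 2) : ℝ) with hρ
  have hρ' : ρ = M / √(n : ℝ) := by rw [hρ, rpow_neg_half_eq, mul_one_div]
  have hR : ρ * (n * (L + 1)) ≤ ((D * n : ℕ) : ℝ) := by
    have h1 : M * (L + 1) ≤ D := Nat.le_ceil _
    have h2 : ρ ≤ M := by
      rw [hρ']
      exact div_le_self hM.le (Real.one_le_sqrt.2 (by exact_mod_cast (by omega : 1 ≤ n)))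
    push_cast
    calc ρ * (n * (L + 1)) ≤ M * (n * (L + 1)) := by gcongr
      _ = M * (L + 1) * n := by ring
      _ ≤ D * n := by gcongr
  have he1 : 1 ≤ ε₀ * √(n : ℝ) := by
    rw [div_le_iff₀ hε₀] at hn1
    linarith
  have hes : ε₀ * √(n : ℝ) ≤ √(n : ℝ) := mul_le_of_le_one_left hs.le hε₀1
  have hKs : 0 ≤ K * √(n : ℝ) := by positivity
  have hnk : n * (K / √(n : ℝ)) = K * √(n : ℝ) := by
    rw [mul_div_assoc', div_eq_iff hs.ne', mul_assoc, hss, mul_comm]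
  have hfix := measure_expansion_error_le Θ hΘ F H hF hH hFm hHm (P n) (Y n) (hY n) (θ n) (θhat n)
    hn hδn.1 hδn.2 hdatan (ρ := ρ) (k := K / √(n : ℝ)) (e := ε₀ * √(n : ℝ))
    (e' := ε₀ * √(n : ℝ)) (v := A * √(n : ℝ)) (v' := (K + 2) * √(n : ℝ)) (l := l) hR hl.le
    (min_le_left _ _) (by positivity) he1 (by simp only [A]; nlinarith)
    (by simp only [A]; nlinarith) (by rw [hnk]; linarith)
  rw [show -(l * (ε₀ * √(n : ℝ))) + 2 * l ^ 2 * (A * √(n : ℝ))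
    = -((l * ε₀ - 2 * l ^ 2 * A) * √(n : ℝ)) by ring] at hfix
  have hlevel : 1 / √((n : ℝ) - 1) * (2 * (3 * (ε₀ * √(n : ℝ)) + 4 * (ε₀ * √(n : ℝ))) + 4)
      + 2 * (K / √(n : ℝ)) ≤ ε := by
    have hn' : (2 : ℝ) ≤ n := by exact_mod_cast hn
    have h1 : 1 / √((n : ℝ) - 1) ≤ 2 / √(n : ℝ) := by
      have h4 : √(n : ℝ) ≤ 2 * √((n : ℝ) - 1) := by
        rw [Real.sqrt_le_left (by positivity), mul_pow, Real.sq_sqrt (by linarith)]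
        linarith
      have h5 : 0 < √((n : ℝ) - 1) := Real.sqrt_pos.2 (by linarith)
      rw [div_le_div_iff₀ h5 hs]
      linarith
    have h2 : (8 + 2 * K) / √(n : ℝ) ≤ ε / 2 := by
      rw [div_le_iff₀ hε] at hn2
      rw [div_le_iff₀ hs]
      linarith
    calc _ ≤ 2 / √(n : ℝ) * (2 * (3 * (ε₀ * √(n : ℝ)) + 4 * (ε₀ * √(n : ℝ))) + 4)
          + 2 * (K / √(n : ℝ)) := by gcongr
      _ = 28 * ε₀ + (8 + 2 * K) / √(n : ℝ) := by field_simp; ring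
      _ ≤ ε := by linarith
  have hsum : ENNReal.ofReal z + ENNReal.ofReal z + ENNReal.ofReal z + ENNReal.ofReal z
      + ENNReal.ofReal z ≤ ζ := by
    calc _ = 5 * ENNReal.ofReal z := by ring
      _ ≤ 5 * (ζ / 5) := by gcongr
      _ = ζ := ENNReal.mul_div_cancel (by norm_num) (by norm_num)
  refine le_trans ?_ hsum
  refine le_trans (measure_mono ?_) ((measure_union_le _ _).trans (add_le_add
    ((measure_union_le _ _).trans (add_le_add ((measure_union_le _ _).trans (add_le_add
    ((measure_union_le _ _).trans (add_le_add hKen hK₁n)) hC2n)) hC3n)) (hfix.trans hbadn)))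
  intro ω hω
  by_contra hcon
  simp only [Set.mem_union, not_or] at hcon
  obtain ⟨⟨⟨⟨g1, g2⟩, g3⟩, g4⟩, g5⟩ := hcon
  have g1' := g1
  rw [Set.mem_ofPred_eq, not_lt] at g1'
  have g2' := g2
  rw [Set.mem_ofPred_eq, not_lt] at g2'
  have g3' := g3
  rw [Set.mem_ofPred_eq, not_lt] at g3'
  have g4' := g4
  rw [Set.mem_ofPred_eq, not_lt] at g4'
  refine g5 ⟨?_, ?_, ?_, ?_, ?_⟩
  · have h1 : √(n : ℝ) * dist (θhat n ω) (θ n) ≤ |Ke| := by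
      rw [mul_one] at g1'
      exact (ENNReal.ofReal_le_ofReal_iff (abs_nonneg _)).1
        (g1'.trans (ENNReal.ofReal_le_ofReal (le_abs_self _)))
    rw [hρ', lt_div_iff₀ hs]
    simp only [M]
    linarith
  · intro r hr t ht
    rw [← ENNReal.ofReal_le_ofReal_iff (by positivity)]
    refine le_trans (le_trans ?_ g2') (ENNReal.ofReal_le_ofReal ?_)
    · exact le_iSup₂_of_le r hr (le_iSup₂_of_le t ht le_rfl)
    · rw [rpow_neg_half_eq, mul_one_div]
      exact div_le_div_of_nonneg_right (le_abs_self _) hs.le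
  · intro r hr
    rw [show ε₀ * √(n : ℝ) / 2 = ε₀ / 2 * √(n : ℝ) by ring]
    exact ofReal_one_div_sqrt_mul_le (by omega)
      ((le_iSup₂_of_le r hr le_rfl).trans g3')
  · intro r hr s hs' hrs
    rw [show ε₀ * √(n : ℝ) / 2 = ε₀ / 2 * √(n : ℝ) by ring]
    exact ofReal_one_div_sqrt_mul_le (by omega)
      ((le_iSup₂_of_le r hr (le_iSup₂_of_le s hs' (by rw [iSup_pos hrs]))).trans g4')
  · have hω' : ENNReal.ofReal ε < _ := hω
    obtain ⟨r₁, h1⟩ := lt_iSup_iff.1 hω'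
    obtain ⟨hr₁, h2⟩ := lt_iSup_iff.1 h1
    obtain ⟨r₂, h3⟩ := lt_iSup_iff.1 h2
    obtain ⟨hr₂, h4⟩ := lt_iSup_iff.1 h3
    exact ⟨r₁, hr₁, r₂, hr₂, hlevel.trans_lt (ENNReal.ofReal_lt_ofReal_iff'.1 h4).1⟩
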